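/- Let $G$ be a graph, that is, a finite connected CW complex all of whose cells have dimension at most $1$, and let $\chi(G)$ be its Euler characteristic, the number of its vertices minus the number of its edges. For a natural number $n$ let $\mathrm{Conf}_n(G)=\{(x_1,\dots,x_n)\in G^n : x_i\ne x_j \text{ for } i\ne j\}$ be the $n$-th ordered configuration space of $G$, with the subspace topology of the product $G^n$, and let $\phi_{n+1}:\mathrm{Conf}_{n+1}(G)\to\mathrm{Conf}_n(G)$ be the forgetting map $(x_1,\dots,x_{n+1})\mapsto(x_1,\dots,x_n)$. Suppose that $\chi(G)<0$ and $n\ge 2-\chi(G)$. Then $\phi_{n+1}$ has no section: there is no continuous map $s:\mathrm{Conf}_n(G)\to\mathrm{Conf}_{n+1}(G)$ with $\phi_{n+1}\circ s=\mathrm{id}_{\mathrm{Conf}_n(G)}$. Equivalently, there is no identifying function: no continuous map $f:\mathrm{Conf}_n(G)\to G$ satisfies $f(x)\ne x_i$ for all $x=(x_1,\dots,x_n)\in\mathrm{Conf}_n(G)$ and all $1\le i\le n$. -/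

import Mathlib

/-- The `n`-th ordered configuration space of `G`: injective `n`-tuples of points of `G`, with the
subspace topology of the product topology on `Fin n → G`. -/
abbrev Conf (n : ℕ) (G : Type*) : Type _ :=
  {x : Fin n → G // Function.Injective x}

/-- The forgetting map `(x₁, …, xₙ, xₙ₊₁) ↦ (x₁, …, xₙ)`. -/
def forget (n : ℕ) (G : Type*) (x : Conf (n + 1) G) : Conf n G :=
  ⟨fun i => x.1 i.castSucc, x.2.comp (Fin.castSucc_injective n)⟩

/-- A section of the forgetting map: a continuous right inverse. -/
def IsSection {n : ℕ} {G : Type*} [TopologicalSpace G] (s : Conf n G → Conf (n + 1) G) : Prop :=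
  Continuous s ∧ forget n G ∘ s = id

/-- An identifying function: a continuous map that avoids every token of each configuration. -/
def IsIdentifyingFunction {n : ℕ} {G : Type*} [TopologicalSpace G] (f : Conf n G → G) : Prop :=
  Continuous f ∧ ∀ (x : Conf n G) (i : Fin n), f x ≠ x.1 i

/-- `G`, with its given cell structure, is a graph: a finite connected (Hausdorff) CW complex
without cells of dimension greater than one. -/
structure IsFiniteGraph (G : Type*) [TopologicalSpace G]
    [Topology.CWComplex (Set.univ : Set G)] : Prop where
  t2 : T2Space G
  connected : ConnectedSpace G
  finite : Topology.CWComplex.Finite (Set.univ : Set G)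
  dim_le_one : ∀ m : ℕ, 1 < m → IsEmpty (Topology.CWComplex.cell (Set.univ : Set G) m)

/-- The Euler characteristic of a finite graph: the number of vertices minus the number of edges. -/
noncomputable def graphEulerChar (G : Type*) [TopologicalSpace G]
    [Topology.CWComplex (Set.univ : Set G)] : ℤ :=
  (Nat.card (Topology.CWComplex.cell (Set.univ : Set G) 0) : ℤ) -
    (Nat.card (Topology.CWComplex.cell (Set.univ : Set G) 1) : ℤ)

/-! A connected graph is a spanning tree together with a finite set `S` of further edges, and `|S| =
1 - χ(G)`. The hypotheses say that `|S| ≥ 2` and `n ≥ |S| + 1`: there are enough tokens to occupy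
every non-tree edge and still keep one token `m` free. Suppose that `F` avoids all tokens.

Fix the tokens other than `m` on the non-tree edges, at least one on each, and remove from every
such edge the arc from its first to its last token. An open tree with `2|S|` ends remains, and
letting `m` move in it gives a map that avoids both the position of `m` and the fixed tokens. By
connectedness its value either always stays in the tree or is always trapped between the outermost
tokens of one edge (`mapsTo_moving_or`). In the first case it is a fixed-point free self-map of an
open tree, which points outwards at exactly one end (`existsUnique_attracting_end`): each vertex
selects the edge towards its image, each inner edge is selected by exactly one of its two endpoints,
and there is one more vertex than there are inner edges. In both cases some configuration has its
value between two neighbouring tokens `u`, `v` of a non-tree edge `i`.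

This situation is rigid. The value cannot leave the arc while `u` and `v` bound it. Since a second
non-tree edge is available for parking, all configurations on non-tree edges in which `v` directly
follows `u` on `i` can be joined by motions that keep `u` and `v` adjacent (`reach_of_eq_on_arc`).
Hence the value lies between `u` and `v` in all of them (`forced_of_mem`).

Forced pairs contradict each other. A single configuration rules out two disjoint forced pairs on
different edges, and also two consecutive ones on the same edge. Two forced pairs on different edges
with a common token would make that token, when moving, point at two ends of a cut tree
(`not_forcedPair_of_common`). So if `{a, b}` is forced on `i` and `m` is a third token, placing `a`
alone on `i` and `b` elsewhere leaves `{a, m}` on `i` as the only possible forced pair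
(`forcedPair_of_forcedPair`). All three pairs among `a`, `b`, `m` are then forced on `i`, and any
choice of their orders contains a consecutive chain. -/

open Set Filter Topology

/-! ### Graph models and their topology -/

/-- A topological space presented as a one-dimensional complex: the points `vertex v` together with
the open arcs `edge e '' Ioo 0 1` partition the space, and each `edge e` is a path on `[0, 1]`
joining `vertex (src e)` to `vertex (tgt e)`. -/
structure GraphModel (G : Type*) [TopologicalSpace G] (V E : Type*) where
  vertex : V → G
  edge : E → ℝ → G
  src : E → V
  tgt : E → V
  continuousOn_edge : ∀ e, ContinuousOn (edge e) (Icc 0 1)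
  edge_zero : ∀ e, edge e 0 = vertex (src e)
  edge_one : ∀ e, edge e 1 = vertex (tgt e)
  vertex_injective : Function.Injective vertex
  edge_inj : ∀ {e e' : E} {t t' : ℝ}, t ∈ Ioo (0 : ℝ) 1 → t' ∈ Ioo (0 : ℝ) 1 →
    edge e t = edge e' t' → e = e' ∧ t = t'
  edge_ne_vertex : ∀ {e : E} {t : ℝ} {v : V}, t ∈ Ioo (0 : ℝ) 1 → edge e t ≠ vertex v
  exists_eq : ∀ x, (∃ v, vertex v = x) ∨ ∃ e, ∃ t ∈ Ioo (0 : ℝ) 1, edge e t = x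

namespace GraphModel

variable {G : Type*} [TopologicalSpace G] {V E : Type*}

/-- Interior points have unique coordinates and the endpoints of edges are vertices. This turns
membership in an open arc or in an inner closed arc into a condition on parameters. -/
lemma edge_mem_image_iff (M : GraphModel G V E) {e e' : E} {t : ℝ} {J : Set ℝ}
    (ht : t ∈ Icc (0 : ℝ) 1) (hJ : J ⊆ Ioo 0 1) :
    M.edge e' t ∈ M.edge e '' J ↔ e' = e ∧ t ∈ J := by
  constructor
  · rintro ⟨u, hu, hut⟩
    rcases eq_or_lt_of_le ht.1 with h0 | h0
    · rw [← h0, M.edge_zero] at hut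
      exact absurd hut (M.edge_ne_vertex (hJ hu))
    rcases eq_or_lt_of_le ht.2 with h1 | h1
    · rw [h1, M.edge_one] at hut
      exact absurd hut (M.edge_ne_vertex (hJ hu))
    obtain ⟨rfl, rfl⟩ := M.edge_inj (hJ hu) ⟨h0, h1⟩ hut
    exact ⟨rfl, hu⟩
  · rintro ⟨rfl, h⟩
    exact ⟨t, h, rfl⟩

lemma isClosed_image_edge [T2Space G] (M : GraphModel G V E) (e : E) {s t : ℝ} (hs : 0 ≤ s)
    (ht : t ≤ 1) :
    IsClosed (M.edge e '' Icc s t) :=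
  (isCompact_Icc.image_of_continuousOn
    ((M.continuousOn_edge e).mono (Icc_subset_Icc hs ht))).isClosed

variable [T2Space G] [Finite V] [Finite E]

/-- Such a set is a finite set of vertices together with finitely many continuous images of compact
sets. So topology on `G` can be tested in the edge parameters. -/
lemma isClosed_of_forall_edge (M : GraphModel G V E) {Y : Set G}
    (h : ∀ e, IsClosed (Icc (0 : ℝ) 1 ∩ M.edge e ⁻¹' Y)) : IsClosed Y := by
  have key : Y = (M.vertex '' (M.vertex ⁻¹' Y)) ∪
      ⋃ e, M.edge e '' (Icc (0 : ℝ) 1 ∩ M.edge e ⁻¹' Y) := by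
    ext x
    simp only [mem_union, mem_iUnion, mem_image, mem_preimage, mem_inter_iff]
    constructor
    · intro hx
      rcases M.exists_eq x with ⟨v, rfl⟩ | ⟨e, t, ht, rfl⟩
      · exact Or.inl ⟨v, hx, rfl⟩
      · exact Or.inr ⟨e, t, ⟨Ioo_subset_Icc_self ht, hx⟩, rfl⟩
    · rintro (⟨v, hv, rfl⟩ | ⟨e, t, ⟨-, hx⟩, rfl⟩)
      exacts [hv, hx]
  rw [key]
  refine IsClosed.union ((toFinite _).image _).isClosed (isClosed_iUnion_of_finite fun e => ?_)
  refine IsCompact.isClosed (IsCompact.image_of_continuousOn ?_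
    ((M.continuousOn_edge e).mono inter_subset_left))
  exact isCompact_Icc.of_isClosed_subset (h e) inter_subset_left

lemma isOpen_image_edge (M : GraphModel G V E) (e : E) {J : Set ℝ} (hJo : IsOpen J)
    (hJ : J ⊆ Ioo 0 1) : IsOpen (M.edge e '' J) := by
  rw [← isClosed_compl_iff]
  refine M.isClosed_of_forall_edge fun e' => ?_
  by_cases he : e' = e
  · have : Icc (0 : ℝ) 1 ∩ M.edge e' ⁻¹' (M.edge e '' J)ᶜ = Icc (0 : ℝ) 1 ∩ Jᶜ := by
      ext t
      simp only [mem_inter_iff, mem_preimage, mem_compl_iff, and_congr_right_iff]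
      intro ht
      rw [M.edge_mem_image_iff ht hJ]
      simp [he]
    rw [this]
    exact isClosed_Icc.inter hJo.isClosed_compl
  · have : Icc (0 : ℝ) 1 ∩ M.edge e' ⁻¹' (M.edge e '' J)ᶜ = Icc (0 : ℝ) 1 := by
      ext t
      simp only [mem_inter_iff, mem_preimage, mem_compl_iff, and_iff_left_iff_imp]
      intro ht
      rw [M.edge_mem_image_iff ht hJ]
      simp [he]
    rw [this]
    exact isClosed_Icc

lemma continuousOn_of_forall_edge (M : GraphModel G V E) {U : Set G} (hU : IsOpen U) {h : G → ℝ}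
    (hh : ∀ e, ContinuousOn (fun t => h (M.edge e t)) (Icc (0 : ℝ) 1 ∩ M.edge e ⁻¹' U)) :
    ContinuousOn h U := by
  rw [continuousOn_open_iff hU]
  intro O hO
  rw [← isClosed_compl_iff]
  refine M.isClosed_of_forall_edge fun e => ?_
  obtain ⟨A, hA, hAU⟩ := (continuousOn_iff'.1 (M.continuousOn_edge e)) U hU
  obtain ⟨B, hB, hBO⟩ := (continuousOn_iff'.1 (hh e)) O hO
  have : Icc (0 : ℝ) 1 ∩ M.edge e ⁻¹' (U ∩ h ⁻¹' O)ᶜ = Icc (0 : ℝ) 1 ∩ (A ∩ B)ᶜ := by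
    ext t
    have h1 := Set.ext_iff.1 hAU t
    have h2 := Set.ext_iff.1 hBO t
    simp only [mem_inter_iff, mem_preimage, mem_compl_iff] at h1 h2 ⊢
    tauto
  rw [this]
  exact isClosed_Icc.inter (hA.inter hB).isClosed_compl

end GraphModel

/-! ### Rooted trees and ancestors -/

/-- A graph model with a chosen rooted spanning tree. The root is `none`; the tree edge `Sum.inl v`
runs from the parent of `v` to `v`, and the remaining edges are indexed by `S`. -/
structure RootedGraph (G : Type*) [TopologicalSpace G] (N S : Type*) extends
    GraphModel G (Option N) (N ⊕ S) where
  tgt_inl : ∀ v, tgt (Sum.inl v) = some v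
  depth : Option N → ℕ
  depth_src_lt : ∀ v, depth (src (Sum.inl v)) < depth (some v)

section Ancestors

variable {M : Type*}

/-- One step from a non-root vertex to its parent. -/
def ParentStep (par : M → Option M) (u w : Option M) : Prop := ∃ v, u = some v ∧ w = par v

/-- `w` is an ancestor of `u`, or `u` itself. -/
def IsAncestor (par : M → Option M) (w u : Option M) : Prop :=
  Relation.ReflTransGen (ParentStep par) u w

variable {par : M → Option M} {d : Option M → ℕ}

lemma IsAncestor.refl (w : Option M) : IsAncestor par w w := Relation.ReflTransGen.refl

lemma isAncestor_parent {v : M} : IsAncestor par (par v) (some v) :=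
  Relation.ReflTransGen.single ⟨v, rfl, rfl⟩

lemma IsAncestor.trans {u v w : Option M} (h : IsAncestor par u v) (h' : IsAncestor par v w) :
    IsAncestor par u w := Relation.ReflTransGen.trans h' h

lemma IsAncestor.depth_le (hd : ∀ v, d (par v) < d (some v)) {u w : Option M}
    (h : IsAncestor par w u) : d w ≤ d u := by
  induction h with
  | refl => exact le_rfl
  | tail _ h ih =>
    obtain ⟨v, rfl, rfl⟩ := h
    exact (hd v).le.trans ih

lemma isAncestor_none (hd : ∀ v, d (par v) < d (some v)) (u : Option M) :
    IsAncestor par none u := by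
  induction h : d u using Nat.strong_induction_on generalizing u with
  | _ k ih =>
    cases u with
    | none => exact IsAncestor.refl _
    | some v => exact (ih _ (h ▸ hd v) _ rfl).trans isAncestor_parent

lemma isAncestor_some_iff {w : Option M} {v : M} (hw : w ≠ some v) :
    IsAncestor par w (some v) ↔ IsAncestor par w (par v) := by
  refine ⟨fun h => ?_, fun h => h.trans isAncestor_parent⟩
  rcases Relation.ReflTransGen.cases_head h with h | ⟨c, ⟨v', hv', rfl⟩, h⟩
  · exact absurd h.symm hw
  · obtain rfl := Option.some.inj hv'
    exact h

lemma not_isAncestor_parent (hd : ∀ v, d (par v) < d (some v)) (v : M) :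
    ¬ IsAncestor par (some v) (par v) :=
  fun h => absurd (h.depth_le hd) (not_le.2 (hd v))

lemma IsAncestor.total {u v w : Option M} (hu : IsAncestor par u w) (hv : IsAncestor par v w) :
    IsAncestor par v u ∨ IsAncestor par u v := by
  refine Relation.ReflTransGen.total_of_right_unique ?_ hu hv
  rintro _ _ _ ⟨a, rfl, rfl⟩ ⟨b, hb, rfl⟩
  rw [Option.some.inj hb]

/-- In a rooted tree, exactly one edge at `w` leads towards a different vertex `u`. -/
lemma existsUnique_edge_towards (hd : ∀ v, d (par v) < d (some v)) {u w : Option M}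
    (huw : u ≠ w) : ∃! v : M, (some v = w ∧ ¬ IsAncestor par (some v) u) ∨
      (par v = w ∧ IsAncestor par (some v) u) := by
  -- If `w` lies above `u`, the edge is the last step of the climb from `u` to `w`; otherwise it is
  -- the edge from `w` up to its parent.
  by_cases hwu : IsAncestor par w u
  · rcases Relation.ReflTransGen.cases_tail hwu with h | ⟨c, hc, ⟨v, rfl, rfl⟩⟩
    · exact absurd h.symm huw
    refine ⟨v, Or.inr ⟨rfl, hc⟩, ?_⟩
    rintro v' (⟨h1, h2⟩ | ⟨h1, h2⟩)
    · rw [h1] at h2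
      exact absurd hwu h2
    · by_contra hne
      -- Two children of `w` above `u` are comparable, so one of them would be an ancestor of the
      -- parent `w` of both, against the depth.
      rcases IsAncestor.total hc h2 with h | h
      · rw [isAncestor_some_iff (by simpa using hne), ← h1] at h
        exact not_isAncestor_parent hd _ h
      · rw [isAncestor_some_iff (by simpa using Ne.symm hne), h1] at h
        exact not_isAncestor_parent hd _ h
  · cases w with
    | none => exact absurd (isAncestor_none hd u) hwu
    | some v =>
      refine ⟨v, Or.inl ⟨rfl, hwu⟩, ?_⟩
      rintro v' (⟨h1, -⟩ | ⟨h1, h2⟩)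
      · exact Option.some.inj h1
      · refine absurd (IsAncestor.trans ?_ h2) hwu
        rw [← h1]
        exact isAncestor_parent

end Ancestors

/-! ### Fixed-point free maps along one edge -/

section EdgeDirection

variable {X : Type*} [TopologicalSpace X] {T : Set X} {g : X → X} {h : X → ℝ} {α : ℝ → X}

/-- Along an edge with coordinate `h`, a fixed-point free map points constantly in one of the two
directions. -/
lemma forall_lt_or_forall_gt_of_fixedPointFree (hg : ContinuousOn g T) (hgT : MapsTo g T T)
    (hfix : ∀ x ∈ T, g x ≠ x) (hh : ContinuousOn h T) (hα : ContinuousOn α (Ioo 0 1))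
    (hαT : MapsTo α (Ioo 0 1) T) (hcoord : ∀ x ∈ T, h x ∈ Ioo (0 : ℝ) 1 → x = α (h x)) :
    (∀ t ∈ Ioo (0 : ℝ) 1, t < h (g (α t))) ∨ ∀ t ∈ Ioo (0 : ℝ) 1, h (g (α t)) < t := by
  have hc : ContinuousOn (fun t => h (g (α t))) (Ioo 0 1) :=
    hh.comp (hg.comp hα hαT) (hgT.comp hαT)
  have hne : ∀ t ∈ Ioo (0 : ℝ) 1, h (g (α t)) ≠ t := by
    intro t ht heq
    have := hcoord _ (hgT (hαT ht)) (heq.symm ▸ ht)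
    rw [heq] at this
    exact hfix _ (hαT ht) this
  by_contra hcon
  push Not at hcon
  obtain ⟨⟨a, ha, ha'⟩, b, hb, hb'⟩ := hcon
  obtain ⟨c, hc1, hc2⟩ := isPreconnected_Ioo.intermediate_value₂ ha hb hc continuousOn_id ha' hb'
  exact hne c hc1 hc2

/-- A fixed-point free map sends the initial vertex of an edge towards that edge exactly if it
points forward along the whole edge. -/
lemma pos_iff_forall_lt_of_fixedPointFree [T2Space X] (hg : ContinuousOn g T) (hgT : MapsTo g T T)
    (hfix : ∀ x ∈ T, g x ≠ x) (hh : ContinuousOn h T) (hα : ContinuousOn α (Ico 0 1))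
    (hαT : MapsTo α (Ico 0 1) T) (hcoord : ∀ x ∈ T, h x ∈ Ioo (0 : ℝ) 1 → x = α (h x))
    (hnonneg : ∀ x ∈ T, 0 ≤ h x) :
    0 < h (g (α 0)) ↔ ∀ t ∈ Ioo (0 : ℝ) 1, t < h (g (α t)) := by
  have h0 : (0 : ℝ) ∈ Ico (0 : ℝ) 1 := by simp
  have hgα : ContinuousOn (fun t => g (α t)) (Ico 0 1) := hg.comp hα hαT
  have hc : ContinuousOn (fun t => h (g (α t))) (Ico 0 1) := hh.comp hgα (hgT.comp hαT)
  have hle : 𝓝[>] (0 : ℝ) ≤ 𝓝[Ico 0 1] 0 := by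
    rw [← nhdsWithin_Ioo_eq_nhdsGT (zero_lt_one : (0 : ℝ) < 1)]
    exact nhdsWithin_mono _ Ioo_subset_Ico_self
  have hIoo : Ioo (0 : ℝ) 1 ∈ 𝓝[>] (0 : ℝ) := Ioo_mem_nhdsGT zero_lt_one
  have hlim : Tendsto (fun t => h (g (α t))) (𝓝[>] 0) (𝓝 (h (g (α 0)))) := (hc 0 h0).mono_left hle
  constructor
  · intro hpos
    refine (forall_lt_or_forall_gt_of_fixedPointFree hg hgT hfix hh (hα.mono Ioo_subset_Ico_self)
      (hαT.mono_left Ioo_subset_Ico_self) hcoord).resolve_right fun hlt => ?_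
    have h1 : Tendsto (fun t : ℝ => t) (𝓝[>] 0) (𝓝 0) := tendsto_id.mono_left nhdsWithin_le_nhds
    have := le_of_tendsto_of_tendsto hlim h1 (by filter_upwards [hIoo] with t ht using (hlt t ht).le)
    linarith
  · intro hall
    -- If the coordinate of `g (α 0)` were `0`, then for small `t` the point `g (α t)` would lie on
    -- the edge with coordinate tending to `0`. It would tend to `α 0`, making `α 0` a fixed point.
    refine lt_of_le_of_ne (hnonneg _ (hgT (hαT h0))) fun heq => ?_
    rw [← heq] at hlim
    have hlim' : Tendsto (fun t => h (g (α t))) (𝓝[>] 0) (𝓝[Ico 0 1] 0) := by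
      refine tendsto_nhdsWithin_iff.2 ⟨hlim, ?_⟩
      filter_upwards [hIoo, hlim.eventually_lt_const zero_lt_one] with t ht ht1
      exact ⟨(ht.1.trans (hall t ht)).le, ht1⟩
    have hA : Tendsto (fun t => α (h (g (α t)))) (𝓝[>] 0) (𝓝 (α 0)) := (hα 0 h0).tendsto.comp hlim'
    have hB : Tendsto (fun t => g (α t)) (𝓝[>] 0) (𝓝 (g (α 0))) := (hgα 0 h0).mono_left hle
    have hEq : (fun t => g (α t)) =ᶠ[𝓝[>] 0] fun t => α (h (g (α t))) := by
      filter_upwards [hIoo, hlim.eventually_lt_const zero_lt_one] with t ht ht1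
      exact hcoord _ (hgT (hαT (Ioo_subset_Ico_self ht))) ⟨ht.1.trans (hall t ht), ht1⟩
    exact hfix _ (hαT h0) (tendsto_nhds_unique (hB.congr' hEq) hA)

/-- The mirror image of `pos_iff_forall_lt_of_fixedPointFree` at the terminal vertex of an edge. -/
lemma lt_one_iff_forall_gt_of_fixedPointFree [T2Space X] (hg : ContinuousOn g T)
    (hgT : MapsTo g T T) (hfix : ∀ x ∈ T, g x ≠ x) (hh : ContinuousOn h T)
    (hα : ContinuousOn α (Ioc 0 1)) (hαT : MapsTo α (Ioc 0 1) T)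
    (hcoord : ∀ x ∈ T, h x ∈ Ioo (0 : ℝ) 1 → x = α (h x)) (hle : ∀ x ∈ T, h x ≤ 1) :
    h (g (α 1)) < 1 ↔ ∀ t ∈ Ioo (0 : ℝ) 1, h (g (α t)) < t := by
  have hmap : MapsTo (fun t : ℝ => 1 - t) (Ico 0 1) (Ioc 0 1) := fun t ht =>
    ⟨by linarith [ht.2], by linarith [ht.1]⟩
  -- Reversing the edge replaces `t` by `1 - t` and `h` by `1 - h`.
  have := pos_iff_forall_lt_of_fixedPointFree (α := fun t => α (1 - t)) (h := fun x => 1 - h x)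
    hg hgT hfix (continuousOn_const.sub hh) (hα.comp (by fun_prop) hmap) (hαT.comp hmap)
    (fun x hx hx' => by
      have := hcoord x hx ⟨by linarith [hx'.2], by linarith [hx'.1]⟩
      simpa using this)
    (fun x hx => by linarith [hle x hx])
  simp only [sub_zero, sub_pos] at this
  rw [this]
  constructor
  · intro H t ht
    have := H (1 - t) ⟨by linarith [ht.2], by linarith [ht.1]⟩
    rw [sub_sub_cancel] at this
    linarith
  · intro H t ht
    have := H (1 - t) ⟨by linarith [ht.2], by linarith [ht.1]⟩
    linarith

end EdgeDirection

/-! ### The attracting end of an open tree -/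

section OpenTree

open Classical in
/-- A fixed-point free self-map of a finite tree with open ends `Λ` points outwards along exactly
one of the ends. The tree has vertices `Option N`, edges `N ⊕ Λ`, and `h m` is the coordinate along
the edge `m`, extended by `0` and `1` to the two sides of that edge. -/
theorem existsUnique_attracting_end {N Λ : Type*} [Finite N] (par : N ⊕ Λ → Option N)
    (d : Option N → ℕ) (hd : ∀ v, d (par (Sum.inl v)) < d (some v))
    {X : Type*} [TopologicalSpace X] [T2Space X] {T : Set X} {g : X → X}
    (hg : ContinuousOn g T) (hgT : MapsTo g T T) (hfix : ∀ x ∈ T, g x ≠ x)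
    (ν : Option N → X) (hν : ∀ w, ν w ∈ T) (α : N ⊕ Λ → ℝ → X)
    (hα : ∀ m, ContinuousOn (α m) (Ico 0 1)) (hα1 : ∀ v, ContinuousOn (α (Sum.inl v)) (Icc 0 1))
    (hαT : ∀ m, MapsTo (α m) (Ico 0 1) T) (hα_zero : ∀ m, α m 0 = ν (par m))
    (hα_one : ∀ v, α (Sum.inl v) 1 = ν (some v))
    (hcover : ∀ x ∈ T, (∃ w, x = ν w) ∨ ∃ m, ∃ t ∈ Ioo (0 : ℝ) 1, x = α m t)
    (h : N ⊕ Λ → X → ℝ) (hh : ∀ m, ContinuousOn (h m) T)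
    (h_vertex : ∀ m w, h m (ν w) =
      if IsAncestor (fun m => (par m).map Sum.inl) (some m) (w.map Sum.inl) then 1 else 0)
    (h_edge : ∀ m m', ∀ t ∈ Ioo (0 : ℝ) 1, h m (α m' t) = if m = m' then t else
      if IsAncestor (fun m => (par m).map Sum.inl) (some m) ((par m').map Sum.inl) then 1 else 0) :
    ∃! l : Λ, ∀ t ∈ Ioo (0 : ℝ) 1, t < h (Sum.inr l) (g (α (Sum.inr l) t)) := by
  -- The open ends are treated as edges to additional leaves, which gives a rooted tree on `Option
  -- (N ⊕ Λ)`; `D` extends the depth by putting each leaf one level below its vertex.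
  set par' : N ⊕ Λ → Option (N ⊕ Λ) := fun m => (par m).map Sum.inl with hpar'
  have hinj : Function.Injective (Option.map (Sum.inl : N → N ⊕ Λ)) :=
    Option.map_injective Sum.inl_injective
  obtain ⟨D, hD⟩ : ∃ D : Option (N ⊕ Λ) → ℕ, ∀ m, D (par' m) < D (some m) := by
    refine ⟨fun w => match w with
      | none => d none
      | some (Sum.inl v) => d (some v)
      | some (Sum.inr l) => d (par (Sum.inr l)) + 1, ?_⟩
    have key : ∀ w : Option N, (match w.map (Sum.inl : N → N ⊕ Λ) with
      | none => d none
      | some (Sum.inl v) => d (some v)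
      | some (Sum.inr l) => d (par (Sum.inr l)) + 1) = d w := by
      rintro (_ | v) <;> rfl
    rintro (v | l)
    · exact (key (par (Sum.inl v))).trans_lt (hd v)
    · exact (key (par (Sum.inr l))).trans_lt (Nat.lt_succ_self _)
  have hcoord : ∀ m, ∀ x ∈ T, h m x ∈ Ioo (0 : ℝ) 1 → x = α m (h m x) := by
    intro m x hx hmx
    rcases hcover x hx with ⟨w, rfl⟩ | ⟨m', t, ht, rfl⟩
    · rw [h_vertex] at hmx
      split_ifs at hmx <;> simp at hmx
    · rw [h_edge m m' t ht] at hmx ⊢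
      split_ifs at hmx ⊢ with h1 h2
      · rw [h1]
      · simp at hmx
      · simp at hmx
  have hbound : ∀ m, ∀ x ∈ T, h m x ∈ Icc (0 : ℝ) 1 := by
    intro m x hx
    rcases hcover x hx with ⟨w, rfl⟩ | ⟨m', t, ht, rfl⟩
    · rw [h_vertex]
      split_ifs <;> simp
    · rw [h_edge m m' t ht]
      split_ifs
      · exact Ioo_subset_Icc_self ht
      · simp
      · simp
  have hforward : ∀ m, 0 < h m (g (ν (par m))) ↔ ∀ t ∈ Ioo (0 : ℝ) 1, t < h m (g (α m t)) := by
    intro m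
    rw [← hα_zero]
    exact pos_iff_forall_lt_of_fixedPointFree hg hgT hfix (hh m) (hα m) (hαT m) (hcoord m)
      fun x hx => (hbound m x hx).1
  have hbackward : ∀ v, h (Sum.inl v) (g (ν (some v))) < 1 ↔
      ∀ t ∈ Ioo (0 : ℝ) 1, h (Sum.inl v) (g (α (Sum.inl v) t)) < t := by
    intro v
    rw [← hα_one]
    refine lt_one_iff_forall_gt_of_fixedPointFree hg hgT hfix (hh _)
      ((hα1 v).mono Ioc_subset_Icc_self) ?_ (hcoord _) fun x hx => (hbound _ x hx).2
    intro t ht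
    rcases eq_or_lt_of_le ht.2 with rfl | h1
    · rw [hα_one]
      exact hν _
    · exact hαT _ ⟨ht.1.le, h1⟩
  -- Each vertex selects the one edge at it that leads towards its image.
  have hselect : ∀ w : Option N, ∃! m, (some m = w.map Sum.inl ∧ h m (g (ν w)) < 1) ∨
      (par m = w ∧ 0 < h m (g (ν w))) := by
    intro w
    have hne : g (ν w) ≠ ν w := hfix _ (hν w)
    rcases hcover _ (hgT (hν w)) with ⟨u, hu⟩ | ⟨m', t, ht, hm'⟩
    · have huw : u.map (Sum.inl : N → N ⊕ Λ) ≠ w.map Sum.inl := by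
        intro heq
        rw [hinj heq] at hu
        exact hne hu
      have := existsUnique_edge_towards hD huw
      rw [hu]
      simp only [h_vertex]
      refine (existsUnique_congr fun m => or_congr (and_congr_right fun _ => ?_)
        (and_congr hinj.eq_iff.symm ?_)).2 this
      · split_ifs with h1 <;> simp [h1]
      · split_ifs with h1 <;> simp [h1]
    · rw [hm']
      simp only [h_edge _ _ t ht]
      -- When the image is interior to the edge `m'`, the far endpoint `some m'` replaces it as the
      -- target. This fails only if `w` is that endpoint, and then `m'` itself is selected.
      by_cases hw : some m' = w.map (Sum.inl : N → N ⊕ Λ)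
      · refine ⟨m', Or.inl ⟨hw, by simpa using ht.2⟩, ?_⟩
        rintro m (⟨h1, -⟩ | ⟨h1, h2⟩)
        · exact Option.some.inj (h1.trans hw.symm)
        · by_contra hmm
          rw [if_neg hmm] at h2
          split_ifs at h2 with h3
          · have h4 : par' m = some m' := by rw [hw, ← h1]
            have h5 : IsAncestor par' (some m) (some m') := h3.trans isAncestor_parent
            rw [← h4] at h5
            exact not_isAncestor_parent hD _ h5
          · exact lt_irrefl _ h2
      · have := existsUnique_edge_towards hD hw
        refine (existsUnique_congr fun m => or_congr (and_congr_right fun hmw => ?_)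
          (and_congr hinj.eq_iff.symm ?_)).2 this
        · have hmm : m ≠ m' := by
            rintro rfl
            exact hw hmw
          rw [if_neg hmm, isAncestor_some_iff (by simpa using hmm)]
          change _ ↔ ¬ IsAncestor par' (some m) ((par m').map Sum.inl)
          split_ifs with h1 <;> simp [h1]
        · by_cases hmm : m = m'
          · subst hmm
            simp [ht.1, IsAncestor.refl]
          · rw [if_neg hmm, isAncestor_some_iff (by simpa using hmm)]
            change _ ↔ IsAncestor par' (some m) ((par m').map Sum.inl)
            split_ifs with h1 <;> simp [h1]
  choose φ hφ hφ_unique using hselect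
  have hhalf : (1 / 2 : ℝ) ∈ Ioo (0 : ℝ) 1 := by norm_num
  have hφ_inr : ∀ w l, φ w = Sum.inr l → par (Sum.inr l) = w ∧
      ∀ t ∈ Ioo (0 : ℝ) 1, t < h (Sum.inr l) (g (α (Sum.inr l) t)) := by
    intro w l hw
    have := hφ w
    simp only [hw] at this
    rcases this with ⟨h1, -⟩ | ⟨h1, h2⟩
    · cases w <;> simp at h1
    · subst h1
      exact ⟨rfl, (hforward _).1 h2⟩
  have hφ_inl : ∀ w v, φ w = Sum.inl v →
      (w = some v ∧ h (Sum.inl v) (g (α (Sum.inl v) (1 / 2))) < 1 / 2) ∨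
      (w = par (Sum.inl v) ∧ 1 / 2 < h (Sum.inl v) (g (α (Sum.inl v) (1 / 2)))) := by
    intro w v hw
    have := hφ w
    simp only [hw] at this
    rcases this with ⟨h1, h2⟩ | ⟨h1, h2⟩
    · obtain rfl : some v = w := hinj h1
      exact Or.inl ⟨rfl, (hbackward v).1 h2 _ hhalf⟩
    · subst h1
      exact Or.inr ⟨rfl, (hforward _).1 h2 _ hhalf⟩
  -- An inner edge selected from both endpoints would have its midpoint pushed in both directions.
  have hφ_injective : Function.Injective φ := by
    intro w w' hww
    rcases hm : φ w with v | l
    · have h1 := hφ_inl w v hm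
      have h2 := hφ_inl w' v (hww ▸ hm)
      rcases h1 with ⟨h1, h1'⟩ | ⟨h1, h1'⟩ <;> rcases h2 with ⟨h2, h2'⟩ | ⟨h2, h2'⟩
      · rw [h1, h2]
      · exact absurd h1' (not_lt.2 h2'.le)
      · exact absurd h1' (not_lt.2 h2'.le)
      · rw [h1, h2]
    · rw [← (hφ_inr w l hm).1, ← (hφ_inr w' l (hww ▸ hm)).1]
  have hφ_surj : ∀ v : N, ∃ w, φ w = Sum.inl v := by
    intro v
    rcases forall_lt_or_forall_gt_of_fixedPointFree hg hgT hfix (hh (Sum.inl v))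
      ((hα _).mono Ioo_subset_Ico_self) ((hαT _).mono_left Ioo_subset_Ico_self)
      (hcoord _) with h1 | h1
    · exact ⟨_, (hφ_unique _ _ (Or.inr ⟨rfl, (hforward _).2 h1⟩)).symm⟩
    · exact ⟨_, (hφ_unique _ _ (Or.inl ⟨rfl, (hbackward _).2 h1⟩)).symm⟩
  have hφ_attr : ∀ l : Λ, (∀ t ∈ Ioo (0 : ℝ) 1, t < h (Sum.inr l) (g (α (Sum.inr l) t))) →
      ∃ w, φ w = Sum.inr l := fun l hl =>
    ⟨_, (hφ_unique _ _ (Or.inr ⟨rfl, (hforward _).2 hl⟩)).symm⟩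
  choose ψ hψ using hφ_surj
  have := Fintype.ofFinite N
  -- Otherwise `|N| + 1` vertices would select distinct edges among only `|N|` inner ones.
  obtain ⟨l, hl⟩ : ∃ l : Λ, ∃ w, φ w = Sum.inr l := by
    by_contra hcon
    push Not at hcon
    have : ∀ w, ∃ v, φ w = Sum.inl v := by
      intro w
      rcases hm : φ w with v | l
      · exact ⟨v, rfl⟩
      · exact absurd hm (hcon l w)
    choose θ hθ using this
    have hθi : Function.Injective θ := fun a b hab => hφ_injective (by rw [hθ, hθ, hab])
    have := Fintype.card_le_of_injective θ hθi
    simp at this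
  obtain ⟨w, hw⟩ := hl
  refine ⟨l, (hφ_inr w l hw).2, fun l' hl' => ?_⟩
  obtain ⟨w', hw'⟩ := hφ_attr l' hl'
  by_contra hne
  -- The vertices selecting two different ends, together with the selectors `ψ v` of the `|N|` inner
  -- edges, would be `|N| + 2` distinct vertices among `|N| + 1`.
  let χ : Option (Option N) → Option N := fun a => a.elim w fun b => b.elim w' ψ
  have hχ : Function.Injective χ := by
    have hww' : w ≠ w' := by
      rintro rfl
      exact hne (Sum.inr.inj (hw'.symm.trans hw))
    have h1 : ∀ v, ψ v ≠ w := fun v hv => by simpa [hv, hw] using hψ v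
    have h2 : ∀ v, ψ v ≠ w' := fun v hv => by simpa [hv, hw'] using hψ v
    have h3 : ∀ v v', ψ v = ψ v' → v = v' := fun v v' hv =>
      Sum.inl.inj (by rw [← hψ v, ← hψ v', hv])
    rintro (_ | _ | v) (_ | _ | v') hvv
    · rfl
    · exact absurd hvv hww'
    · exact absurd hvv.symm (h1 _)
    · exact absurd hvv.symm hww'
    · rfl
    · exact absurd hvv.symm (h2 _)
    · exact absurd hvv (h1 _)
    · exact absurd hvv (h2 _)
    · rw [h3 v v' hvv]
  have := Fintype.card_le_of_injective χ hχ
  simp at this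

end OpenTree

/-! ### Real functions given edge by edge -/

namespace GraphModel

variable {G : Type*} [TopologicalSpace G] {V E : Type*}

open Classical in
/-- The function on `G` with value `a v` at the vertex `v` and `b e t` at the interior point of the
edge `e` with parameter `t`. -/
noncomputable def lift (M : GraphModel G V E) (a : V → ℝ) (b : E → ℝ → ℝ) (x : G) : ℝ :=
  if h : ∃ v, M.vertex v = x then a h.choose
  else if h : ∃ e : E × ℝ, e.2 ∈ Ioo (0 : ℝ) 1 ∧ M.edge e.1 e.2 = x then
    b h.choose.1 h.choose.2 else 0

lemma lift_vertex (M : GraphModel G V E) (a : V → ℝ) (b : E → ℝ → ℝ) (v : V) :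
    M.lift a b (M.vertex v) = a v := by
  have h : ∃ v', M.vertex v' = M.vertex v := ⟨v, rfl⟩
  rw [lift, dif_pos h, M.vertex_injective h.choose_spec]

lemma lift_edge (M : GraphModel G V E) (a : V → ℝ) (b : E → ℝ → ℝ) (e : E) {t : ℝ}
    (ht : t ∈ Ioo (0 : ℝ) 1) : M.lift a b (M.edge e t) = b e t := by
  have h0 : ¬ ∃ v, M.vertex v = M.edge e t := fun ⟨v, hv⟩ => M.edge_ne_vertex ht hv.symm
  have h : ∃ e' : E × ℝ, e'.2 ∈ Ioo (0 : ℝ) 1 ∧ M.edge e'.1 e'.2 = M.edge e t := ⟨(e, t), ht, rfl⟩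
  rw [lift, dif_neg h0, dif_pos h]
  obtain ⟨h1, h2⟩ := M.edge_inj h.choose_spec.1 ht h.choose_spec.2
  rw [h1, h2]

lemma lift_edge_of_mem_Icc (M : GraphModel G V E) {a : V → ℝ} {b : E → ℝ → ℝ} {e : E}
    (h0 : b e 0 = a (M.src e)) (h1 : b e 1 = a (M.tgt e)) {t : ℝ} (ht : t ∈ Icc (0 : ℝ) 1) :
    M.lift a b (M.edge e t) = b e t := by
  rcases eq_or_lt_of_le ht.1 with h | h
  · rw [← h, M.edge_zero, M.lift_vertex, h0]
  rcases eq_or_lt_of_le ht.2 with h' | h'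
  · rw [h', M.edge_one, M.lift_vertex, h1]
  · exact M.lift_edge a b e ⟨h, h'⟩

lemma continuousOn_lift [T2Space G] [Finite V] [Finite E] (M : GraphModel G V E) {a : V → ℝ}
    {b : E → ℝ → ℝ} {U : Set G} (hU : IsOpen U) (h0 : ∀ e, b e 0 = a (M.src e))
    (h1 : ∀ e, b e 1 = a (M.tgt e))
    (hb : ∀ e, ContinuousOn (b e) (Icc (0 : ℝ) 1 ∩ M.edge e ⁻¹' U)) :
    ContinuousOn (M.lift a b) U :=
  M.continuousOn_of_forall_edge hU fun e =>
    (hb e).congr fun _ ht => M.lift_edge_of_mem_Icc (h0 e) (h1 e) ht.1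

end GraphModel

/-! ### The cut tree, its coordinates and its ends -/

namespace RootedGraph

variable {G : Type*} [TopologicalSpace G] {N S : Type*}

/-- The complement of the arcs `[p i, q i]` on the non-tree edges. -/
def cutTree (R : RootedGraph G N S) (p q : S → ℝ) : Set G :=
  {x | ∀ i, x ∉ R.edge (Sum.inr i) '' Icc (p i) (q i)}

lemma vertex_mem_cutTree (R : RootedGraph G N S) {p q : S → ℝ} (hp : ∀ i, 0 < p i)
    (hq : ∀ i, q i < 1) (w : Option N) : R.vertex w ∈ R.cutTree p q := by
  rintro i ⟨t, ht, hv⟩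
  exact R.edge_ne_vertex ⟨(hp i).trans_le ht.1, ht.2.trans_lt (hq i)⟩ hv

lemma edge_inl_mem_cutTree (R : RootedGraph G N S) {p q : S → ℝ} (hp : ∀ i, 0 < p i)
    (hq : ∀ i, q i < 1) (v : N) {t : ℝ} (ht : t ∈ Icc (0 : ℝ) 1) :
    R.edge (Sum.inl v) t ∈ R.cutTree p q := by
  intro i hi
  rw [R.edge_mem_image_iff ht fun t ht => ⟨(hp i).trans_le ht.1, ht.2.trans_lt (hq i)⟩] at hi
  simp at hi

lemma edge_inr_mem_cutTree_iff (R : RootedGraph G N S) {p q : S → ℝ} (hp : ∀ i, 0 < p i)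
    (hq : ∀ i, q i < 1) (i : S) {t : ℝ} (ht : t ∈ Icc (0 : ℝ) 1) :
    R.edge (Sum.inr i) t ∈ R.cutTree p q ↔ t ∉ Icc (p i) (q i) := by
  constructor
  · intro h h'
    exact h i ⟨t, h', rfl⟩
  · intro h j hj
    rw [R.edge_mem_image_iff ht fun t ht => ⟨(hp j).trans_le ht.1, ht.2.trans_lt (hq j)⟩] at hj
    obtain ⟨h1, h2⟩ := hj
    obtain rfl := Sum.inr.inj h1
    exact h h2

lemma isOpen_cutTree [T2Space G] [Finite S] (R : RootedGraph G N S) {p q : S → ℝ}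
    (hp : ∀ i, 0 < p i) (hq : ∀ i, q i < 1) : IsOpen (R.cutTree p q) := by
  have : R.cutTree p q = ⋂ i, (R.edge (Sum.inr i) '' Icc (p i) (q i))ᶜ := by
    ext x
    simp [cutTree]
  rw [this]
  exact isOpen_iInter_of_finite fun i =>
    (R.isClosed_image_edge _ (hp i).le (hq i).le).isOpen_compl

/-- The vertex from which an edge of the cut tree starts; the open ends are indexed by
`S × Bool`. -/
def cutParent (R : RootedGraph G N S) : N ⊕ S × Bool → Option N
  | Sum.inl v => R.src (Sum.inl v)
  | Sum.inr (i, true) => R.src (Sum.inr i)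
  | Sum.inr (i, false) => R.tgt (Sum.inr i)

/-- Parametrizations of the edges of the cut tree. -/
def cutEdge (R : RootedGraph G N S) (p q : S → ℝ) : N ⊕ S × Bool → ℝ → G
  | Sum.inl v, t => R.edge (Sum.inl v) t
  | Sum.inr (i, true), t => R.edge (Sum.inr i) (t * p i)
  | Sum.inr (i, false), t => R.edge (Sum.inr i) (1 - t * (1 - q i))

/-- Climbing from a vertex of the spanning tree passes through such vertices only, with depth not
increasing. Hence an open end is never above a vertex, and an edge is never above its own starting
vertex. -/
lemma exists_of_isAncestor_map_inl (R : RootedGraph G N S) {x : Option (N ⊕ S × Bool)}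
    {w : Option N} (h : IsAncestor (fun m => (R.cutParent m).map Sum.inl) x (w.map Sum.inl)) :
    ∃ u : Option N, x = u.map Sum.inl ∧ R.depth u ≤ R.depth w := by
  unfold IsAncestor at h
  induction h with
  | refl => exact ⟨w, rfl, le_rfl⟩
  | tail _ h ih =>
    obtain ⟨u, hu, hle⟩ := ih
    obtain ⟨m, hm, rfl⟩ := h
    refine ⟨_, rfl, ?_⟩
    rw [hu] at hm
    cases u with
    | none => simp at hm
    | some v =>
      obtain rfl : Sum.inl v = m := Option.some.inj hm
      exact (R.depth_src_lt v).le.trans hle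

lemma not_isAncestor_inr (R : RootedGraph G N S) (l : S × Bool) (w : Option N) :
    ¬ IsAncestor (fun m => (R.cutParent m).map Sum.inl) (some (Sum.inr l)) (w.map Sum.inl) := by
  intro h
  obtain ⟨u, hu, -⟩ := R.exists_of_isAncestor_map_inl h
  cases u <;> simp at hu

lemma not_isAncestor_src (R : RootedGraph G N S) (v : N) :
    ¬ IsAncestor (fun m => (R.cutParent m).map Sum.inl) (some (Sum.inl v))
      ((R.src (Sum.inl v)).map Sum.inl) := by
  intro h
  obtain ⟨u, hu, hle⟩ := R.exists_of_isAncestor_map_inl h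
  obtain rfl : some v = u := Option.map_injective Sum.inl_injective hu
  exact absurd hle (not_le.2 (R.depth_src_lt v))

open Classical in
/-- The indicator of the descendants of the edge `m`. -/
noncomputable def below (R : RootedGraph G N S) (m : N ⊕ S × Bool) (w : Option N) : ℝ :=
  if IsAncestor (fun m => (R.cutParent m).map Sum.inl) (some m) (w.map Sum.inl) then 1 else 0

lemma below_inr (R : RootedGraph G N S) (l : S × Bool) (w : Option N) :
    R.below (Sum.inr l) w = 0 := if_neg (R.not_isAncestor_inr l w)

open Classical in
/-- The coordinate along the edge `m` of the cut tree in terms of the edge parameters. -/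
noncomputable def cutCoordEdge (R : RootedGraph G N S) (p q : S → ℝ) (m : N ⊕ S × Bool) :
    N ⊕ S → ℝ → ℝ
  | Sum.inl v, t => if m = Sum.inl v then t else R.below m (R.src (Sum.inl v))
  | Sum.inr i, t => if t < p i then
      (if m = Sum.inr (i, true) then t / p i else R.below m (R.src (Sum.inr i)))
    else if m = Sum.inr (i, false) then (1 - t) / (1 - q i) else R.below m (R.tgt (Sum.inr i))

/-- The coordinate along the edge `m` of the cut tree. -/
noncomputable def cutCoord (R : RootedGraph G N S) (p q : S → ℝ) (m : N ⊕ S × Bool) : G → ℝ :=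
  R.lift (R.below m) (R.cutCoordEdge p q m)

-- The edge formulas agree with `below` at the vertices, and on a non-tree edge the switch between
-- the two branches takes place inside the removed arc.
open Classical in
lemma continuousOn_cutCoord [T2Space G] [Finite N] [Finite S] (R : RootedGraph G N S)
    {p q : S → ℝ} (hp : ∀ i, 0 < p i) (hpq : ∀ i, p i ≤ q i) (hq : ∀ i, q i < 1)
    (m : N ⊕ S × Bool) : ContinuousOn (R.cutCoord p q m) (R.cutTree p q) := by
  refine R.continuousOn_lift (R.isOpen_cutTree hp hq) ?_ ?_ ?_
  · rintro (v | i)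
    · simp only [cutCoordEdge]
      split_ifs with h
      · rw [h, below, if_neg (R.not_isAncestor_src v)]
      · rfl
    · simp only [cutCoordEdge, if_pos (hp i)]
      split_ifs with h
      · rw [h, below_inr, zero_div]
      · rfl
  · rintro (v | i)
    · simp only [cutCoordEdge, R.tgt_inl]
      split_ifs with h
      · rw [h]
        exact (if_pos (IsAncestor.refl _)).symm
      · have hm : some m ≠ some (Sum.inl v) := by simpa using h
        have := isAncestor_some_iff (par := fun m => (R.cutParent m).map Sum.inl) hm
        exact if_congr this.symm rfl rfl
    · have h1 : ¬ 1 < p i := not_lt.2 ((hpq i).trans (hq i).le)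
      simp only [cutCoordEdge, if_neg h1]
      split_ifs with h
      · rw [h, below_inr, sub_self, zero_div]
      · rfl
  · rintro (v | i)
    · by_cases hm : m = Sum.inl v
      · exact continuousOn_id.congr fun t _ => if_pos hm
      · exact continuousOn_const.congr fun t _ => if_neg hm
    · rintro t ⟨ht, htT⟩
      rw [mem_preimage, R.edge_inr_mem_cutTree_iff hp hq i ht] at htT
      refine ContinuousAt.continuousWithinAt ?_
      rcases lt_or_ge t (p i) with hlt | hge
      · have : (if m = Sum.inr (i, true) then fun t => t / p i
            else fun _ => R.below m (R.src (Sum.inr i))) =ᶠ[𝓝 t]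
            R.cutCoordEdge p q m (Sum.inr i) := by
          filter_upwards [eventually_lt_nhds hlt] with s hs
          simp only [cutCoordEdge, if_pos hs]
          split_ifs <;> rfl
        refine ContinuousAt.congr ?_ this
        split_ifs <;> fun_prop
      · have hgt : q i < t := not_le.1 fun h => htT ⟨hge, h⟩
        have : (if m = Sum.inr (i, false) then fun t => (1 - t) / (1 - q i)
            else fun _ => R.below m (R.tgt (Sum.inr i))) =ᶠ[𝓝 t]
            R.cutCoordEdge p q m (Sum.inr i) := by
          filter_upwards [eventually_gt_nhds hgt] with s hs
          simp only [cutCoordEdge, if_neg (not_lt.2 ((hpq i).trans hs.le))]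
          split_ifs <;> rfl
        refine ContinuousAt.congr ?_ this
        split_ifs <;> fun_prop

/-- A map points outwards at an end of the cut tree. -/
def PointsOutward (R : RootedGraph G N S) (p q : S → ℝ) (g : G → G) : S × Bool → Prop
  | (i, true) => ∀ t ∈ Ioo 0 (p i), ∃ u ∈ Ioo t (p i), g (R.edge (Sum.inr i) t) =
      R.edge (Sum.inr i) u
  | (i, false) => ∀ t ∈ Ioo (q i) 1, ∃ u ∈ Ioo (q i) t, g (R.edge (Sum.inr i) t) =
      R.edge (Sum.inr i) u

lemma cutCoord_inr_true (R : RootedGraph G N S) {p q : S → ℝ} (i : S) {t : ℝ} (ht : 0 < t)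
    (hp : t < p i) (hp1 : p i < 1) :
    R.cutCoord p q (Sum.inr (i, true)) (R.edge (Sum.inr i) t) = t / p i := by
  rw [cutCoord, R.lift_edge _ _ _ ⟨ht, hp.trans hp1⟩]
  simp [cutCoordEdge, hp]

lemma cutCoord_inr_false (R : RootedGraph G N S) {p q : S → ℝ} (i : S) {t : ℝ} (ht : t < 1)
    (hp : q i < t) (hp0 : 0 < p i) (hpq : p i ≤ q i) :
    R.cutCoord p q (Sum.inr (i, false)) (R.edge (Sum.inr i) t) = (1 - t) / (1 - q i) := by
  rw [cutCoord, R.lift_edge _ _ _ ⟨by linarith, ht⟩]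
  have : ¬ t < p i := by linarith
  simp [cutCoordEdge, this]

/-- Nothing descends from an open end, so its coordinate vanishes off the end itself. A positive
coordinate therefore locates the point. -/
lemma exists_of_cutCoord_true_pos (R : RootedGraph G N S) {p q : S → ℝ} {i : S} {x : G}
    (hpos : 0 < R.cutCoord p q (Sum.inr (i, true)) x) :
    ∃ u ∈ Ioo 0 (p i), x = R.edge (Sum.inr i) u := by
  rcases R.exists_eq x with ⟨w, rfl⟩ | ⟨v | j, t, ht, rfl⟩
  · rw [cutCoord, R.lift_vertex, below_inr] at hpos
    exact absurd hpos (lt_irrefl _)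
  · rw [cutCoord, R.lift_edge _ _ _ ht] at hpos
    simp [cutCoordEdge, below_inr] at hpos
  · rw [cutCoord, R.lift_edge _ _ _ ht] at hpos
    simp only [cutCoordEdge, below_inr, Sum.inr.injEq, Prod.mk.injEq, Bool.true_eq_false,
      and_false, if_false, and_true] at hpos
    split_ifs at hpos with h1 h2
    · obtain rfl : i = j := by simpa using h2
      exact ⟨t, ⟨ht.1, h1⟩, rfl⟩
    · exact absurd hpos (lt_irrefl _)
    · exact absurd hpos (lt_irrefl _)

lemma exists_of_cutCoord_false_pos (R : RootedGraph G N S) {p q : S → ℝ} (hp : ∀ i, 0 < p i)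
    (hq : ∀ i, q i < 1) {i : S} {x : G} (hx : x ∈ R.cutTree p q)
    (hpos : 0 < R.cutCoord p q (Sum.inr (i, false)) x) :
    ∃ u ∈ Ioo (q i) 1, x = R.edge (Sum.inr i) u := by
  rcases R.exists_eq x with ⟨w, rfl⟩ | ⟨v | j, t, ht, rfl⟩
  · rw [cutCoord, R.lift_vertex, below_inr] at hpos
    exact absurd hpos (lt_irrefl _)
  · rw [cutCoord, R.lift_edge _ _ _ ht] at hpos
    simp [cutCoordEdge, below_inr] at hpos
  · rw [R.edge_inr_mem_cutTree_iff hp hq j (Ioo_subset_Icc_self ht)] at hx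
    rw [cutCoord, R.lift_edge _ _ _ ht] at hpos
    simp only [cutCoordEdge, below_inr, Sum.inr.injEq, Prod.mk.injEq, Bool.false_eq_true,
      and_false, if_false, and_true] at hpos
    split_ifs at hpos with h1 h2
    · exact absurd hpos (lt_irrefl _)
    · obtain rfl : i = j := by simpa using h2
      exact ⟨t, ⟨not_le.1 fun h' => hx ⟨not_lt.1 h1, h'⟩, ht.2⟩, rfl⟩
    · exact absurd hpos (lt_irrefl _)

/-- A fixed-point free self-map of the cut tree points outwards at exactly one end. -/
theorem existsUnique_pointsOutward [T2Space G] [Finite N] [Finite S] (R : RootedGraph G N S)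
    {p q : S → ℝ} (hp : ∀ i, 0 < p i) (hpq : ∀ i, p i ≤ q i) (hq : ∀ i, q i < 1) {g : G → G}
    (hg : ContinuousOn g (R.cutTree p q)) (hgT : MapsTo g (R.cutTree p q) (R.cutTree p q))
    (hfix : ∀ x ∈ R.cutTree p q, g x ≠ x) : ∃! l, R.PointsOutward p q g l := by
  classical
  have hp1 : ∀ i, p i < 1 := fun i => (hpq i).trans_lt (hq i)
  have hq0 : ∀ i, 0 < q i := fun i => (hp i).trans_le (hpq i)
  have hmapt : ∀ i, ∀ t ∈ Ico (0 : ℝ) 1, t * p i ∈ Ico 0 (p i) := fun i t ht =>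
    ⟨mul_nonneg ht.1 (hp i).le, by nlinarith [hp i, ht.2]⟩
  have hmapf : ∀ i, ∀ t ∈ Ico (0 : ℝ) 1, 1 - t * (1 - q i) ∈ Ioc (q i) 1 := fun i t ht =>
    ⟨by nlinarith [hq i, ht.2], by nlinarith [hq i, ht.1]⟩
  have key := existsUnique_attracting_end R.cutParent R.depth R.depth_src_lt hg hgT hfix R.vertex
    (R.vertex_mem_cutTree hp hq) (R.cutEdge p q) ?_ (fun v => R.continuousOn_edge _) ?_ ?_ ?_ ?_
    (R.cutCoord p q) (R.continuousOn_cutCoord hp hpq hq) (fun m w => ?_) ?_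
  · refine (existsUnique_congr fun l => ?_).1 key
    obtain ⟨i, _ | _⟩ := l
    · have hqi : 0 < 1 - q i := by linarith [hq i]
      constructor
      · intro H t ht
        have ht' : (1 - t) / (1 - q i) ∈ Ioo (0 : ℝ) 1 :=
          ⟨div_pos (by linarith [ht.2]) hqi, by rw [div_lt_one hqi]; linarith [ht.1]⟩
        have h1 := H _ ht'
        simp only [cutEdge, div_mul_cancel₀ _ hqi.ne', sub_sub_cancel] at h1
        obtain ⟨u, hu, hgu⟩ := R.exists_of_cutCoord_false_pos hp hq
          (hgT ((R.edge_inr_mem_cutTree_iff hp hq i ⟨by linarith [ht.1, hq0 i], ht.2.le⟩).2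
            fun h => absurd h.2 (not_le.2 ht.1))) (ht'.1.trans h1)
        rw [hgu, R.cutCoord_inr_false i hu.2 hu.1 (hp i) (hpq i),
          div_lt_div_iff_of_pos_right hqi] at h1
        exact ⟨u, ⟨hu.1, by linarith⟩, hgu⟩
      · intro H t ht
        have h2 := hmapf i t (Ioo_subset_Ico_self ht)
        have h3 : 1 - t * (1 - q i) < 1 := by nlinarith [ht.1]
        obtain ⟨u, hu, hgu⟩ := H _ ⟨h2.1, h3⟩
        simp only [cutEdge]
        rw [hgu, R.cutCoord_inr_false i (hu.2.trans h3) hu.1 (hp i) (hpq i), lt_div_iff₀ hqi]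
        linarith [hu.2]
    · constructor
      · intro H t ht
        have ht' : t / p i ∈ Ioo (0 : ℝ) 1 :=
          ⟨div_pos ht.1 (hp i), by rw [div_lt_one (hp i)]; exact ht.2⟩
        have h1 := H _ ht'
        simp only [cutEdge, div_mul_cancel₀ _ (hp i).ne'] at h1
        obtain ⟨u, hu, hgu⟩ := R.exists_of_cutCoord_true_pos (ht'.1.trans h1)
        rw [hgu, R.cutCoord_inr_true i hu.1 hu.2 (hp1 i),
          div_lt_div_iff_of_pos_right (hp i)] at h1
        exact ⟨u, ⟨h1, hu.2⟩, hgu⟩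
      · intro H t ht
        have h2 := hmapt i t (Ioo_subset_Ico_self ht)
        have h3 : 0 < t * p i := mul_pos ht.1 (hp i)
        obtain ⟨u, hu, hgu⟩ := H _ ⟨h3, h2.2⟩
        simp only [cutEdge]
        rw [hgu, R.cutCoord_inr_true i (h3.trans hu.1) hu.2 (hp1 i), lt_div_iff₀ (hp i)]
        exact hu.1
  · rintro (v | ⟨i, _ | _⟩)
    · exact (R.continuousOn_edge _).mono Ico_subset_Icc_self
    · exact (R.continuousOn_edge _).comp (by fun_prop) fun t ht =>
        ⟨((hq0 i).trans (hmapf i t ht).1).le, (hmapf i t ht).2⟩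
    · exact (R.continuousOn_edge _).comp (by fun_prop) fun t ht =>
        ⟨(hmapt i t ht).1, ((hmapt i t ht).2.trans (hp1 i)).le⟩
  · rintro (v | ⟨i, _ | _⟩) t ht
    · exact R.edge_inl_mem_cutTree hp hq v (Ico_subset_Icc_self ht)
    · have h := hmapf i t ht
      exact (R.edge_inr_mem_cutTree_iff hp hq i ⟨by linarith [hq0 i, h.1], h.2⟩).2
        fun h' => absurd h'.2 (not_le.2 h.1)
    · have h := hmapt i t ht
      exact (R.edge_inr_mem_cutTree_iff hp hq i ⟨h.1, by linarith [hp1 i, h.2]⟩).2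
        fun h' => absurd h'.1 (not_le.2 h.2)
  · rintro (v | ⟨i, _ | _⟩)
    · exact R.edge_zero _
    · simp only [cutEdge, zero_mul, sub_zero]
      exact R.edge_one _
    · simp only [cutEdge, zero_mul]
      exact R.edge_zero _
  · intro v
    simp only [cutEdge]
    rw [R.edge_one, R.tgt_inl]
  · intro x hx
    rcases R.exists_eq x with ⟨w, rfl⟩ | ⟨v | i, t, ht, rfl⟩
    · exact Or.inl ⟨w, rfl⟩
    · exact Or.inr ⟨Sum.inl v, t, ht, rfl⟩
    · rw [R.edge_inr_mem_cutTree_iff hp hq i (Ioo_subset_Icc_self ht)] at hx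
      right
      rcases lt_or_ge t (p i) with h | h
      · refine ⟨Sum.inr (i, true), t / p i, ⟨div_pos ht.1 (hp i), ?_⟩, ?_⟩
        · rwa [div_lt_one (hp i)]
        · simp only [cutEdge, div_mul_cancel₀ _ (hp i).ne']
      · have hgt : q i < t := not_le.1 fun h' => hx ⟨h, h'⟩
        have hqi : 0 < 1 - q i := by linarith [hq i]
        refine ⟨Sum.inr (i, false), (1 - t) / (1 - q i), ⟨div_pos (by linarith [ht.2]) hqi, ?_⟩, ?_⟩
        · rw [div_lt_one hqi]
          linarith
        · simp only [cutEdge, div_mul_cancel₀ _ hqi.ne', sub_sub_cancel]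
  · exact R.lift_vertex _ _ _
  · rintro m (v | ⟨i, _ | _⟩) t ht
    · simp only [cutEdge, cutCoord]
      rw [R.lift_edge _ _ _ ht]
      simp only [cutCoordEdge, below]
      by_cases hm : m = Sum.inl v
      · rw [if_pos hm, if_pos hm]
      · rw [if_neg hm, if_neg hm]
        rfl
    · have h := hmapf i t (Ioo_subset_Ico_self ht)
      have hqi : 0 < 1 - q i := by linarith [hq i]
      have h3 : 1 - t * (1 - q i) < 1 := by nlinarith [ht.1]
      have h4 : ¬ 1 - t * (1 - q i) < p i := not_lt.2 ((hpq i).trans h.1.le)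
      simp only [cutEdge, cutCoord]
      rw [R.lift_edge _ _ _ ⟨by linarith [hq0 i, h.1], h3⟩]
      simp only [cutCoordEdge, below, if_neg h4, sub_sub_cancel,
        mul_div_cancel_right₀ _ hqi.ne']
      by_cases hm : m = Sum.inr (i, false)
      · rw [if_pos hm, if_pos hm]
      · rw [if_neg hm, if_neg hm]
        rfl
    · have h := hmapt i t (Ioo_subset_Ico_self ht)
      simp only [cutEdge, cutCoord]
      rw [R.lift_edge _ _ _ ⟨mul_pos ht.1 (hp i), h.2.trans (hp1 i)⟩]
      simp only [cutCoordEdge, below, if_pos h.2, mul_div_cancel_right₀ _ (hp i).ne']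
      by_cases hm : m = Sum.inr (i, true)
      · rw [if_pos hm, if_pos hm]
      · rw [if_neg hm, if_neg hm]
        rfl

end RootedGraph

/-! ### Values trapped in a moving arc -/

namespace GraphModel

variable {G : Type*} [TopologicalSpace G] {V E : Type*}

/-- A continuous function which avoids the two moving ends of an arc cannot enter or leave the
arc. -/
lemma mem_arc_of_preconnected [T2Space G] [Finite V] [Finite E] (M : GraphModel G V E) (e : E)
    {Z : Type*} [TopologicalSpace Z] [PreconnectedSpace Z] {φ : Z → G} {s t : Z → ℝ}
    (hφ : Continuous φ) (hs : Continuous s) (ht : Continuous t) (hs0 : ∀ z, 0 < s z)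
    (hst : ∀ z, s z < t z) (ht1 : ∀ z, t z < 1) (hφs : ∀ z, φ z ≠ M.edge e (s z))
    (hφt : ∀ z, φ z ≠ M.edge e (t z)) {z z' : Z} (hz : φ z ∈ M.edge e '' Ioo (s z) (t z)) :
    φ z' ∈ M.edge e '' Ioo (s z') (t z') := by
  have hopen : IsOpen {z | φ z ∈ M.edge e '' Ioo (s z) (t z)} := by
    rw [isOpen_iff_mem_nhds]
    rintro z₀ ⟨u, hu, huz⟩
    obtain ⟨a, ha, ha'⟩ := exists_between hu.1
    obtain ⟨b, hb, hb'⟩ := exists_between hu.2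
    have h1 : M.edge e '' Ioo a b ∈ 𝓝 (φ z₀) :=
      (M.isOpen_image_edge e isOpen_Ioo
        (Ioo_subset_Ioo ((hs0 z₀).trans ha).le (hb'.trans (ht1 z₀)).le)).mem_nhds
        ⟨u, ⟨ha', hb⟩, huz⟩
    filter_upwards [hφ.continuousAt h1, hs.continuousAt.eventually_lt_const ha,
      ht.continuousAt.eventually_const_lt hb'] with z h2 h3 h4
    exact image_mono (Ioo_subset_Ioo h3.le h4.le) h2
  have hclosed : IsOpen {z | φ z ∈ M.edge e '' Ioo (s z) (t z)}ᶜ := by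
    rw [isOpen_iff_mem_nhds]
    intro z₀ hz₀
    -- The value also misses the ends of the arc, so it misses a slightly larger closed arc, which
    -- contains the arcs of all nearby `z`.
    obtain ⟨a, b, ha0, ha, hb, hb1, hab⟩ : ∃ a b, 0 < a ∧ a < s z₀ ∧ t z₀ < b ∧ b < 1 ∧
        φ z₀ ∉ M.edge e '' Icc a b := by
      have hnot : φ z₀ ∉ M.edge e '' Icc (s z₀) (t z₀) := by
        rintro ⟨u, hu, huz⟩
        rcases eq_or_lt_of_le hu.1 with h | h
        · exact hφs z₀ (by rw [h, huz])
        rcases eq_or_lt_of_le hu.2 with h' | h'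
        · exact hφt z₀ (by rw [← h', huz])
        · exact hz₀ ⟨u, ⟨h, h'⟩, huz⟩
      have hs1 := hst z₀
      by_cases hedge : ∃ u ∈ Ioo (0 : ℝ) 1, M.edge e u = φ z₀
      · obtain ⟨u, hu, huz⟩ := hedge
        rw [← huz, M.edge_mem_image_iff (Ioo_subset_Icc_self hu)
          fun x hx => ⟨(hs0 z₀).trans_le hx.1, hx.2.trans_lt (ht1 z₀)⟩] at hnot
        have hout : u < s z₀ ∨ t z₀ < u := by
          by_contra hcon
          push Not at hcon
          exact hnot ⟨rfl, hcon⟩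
        rcases hout with h | h
        · refine ⟨(u + s z₀) / 2, (t z₀ + 1) / 2, by linarith [hu.1, hs0 z₀], by linarith,
            by linarith [ht1 z₀], by linarith [ht1 z₀], ?_⟩
          rw [← huz, M.edge_mem_image_iff (Ioo_subset_Icc_self hu)
            fun x hx => ⟨by linarith [hx.1, hu.1, hs0 z₀], by linarith [hx.2, ht1 z₀]⟩]
          rintro ⟨-, h1, -⟩
          linarith
        · refine ⟨s z₀ / 2, (t z₀ + u) / 2, by linarith [hs0 z₀], by linarith [hs0 z₀],
            by linarith, by linarith [hu.2, ht1 z₀], ?_⟩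
          rw [← huz, M.edge_mem_image_iff (Ioo_subset_Icc_self hu)
            fun x hx => ⟨by linarith [hx.1, hs0 z₀], by linarith [hx.2, hu.2, ht1 z₀]⟩]
          rintro ⟨-, -, h1⟩
          linarith
      · refine ⟨s z₀ / 2, (t z₀ + 1) / 2, by linarith [hs0 z₀], by linarith [hs0 z₀],
          by linarith [ht1 z₀], by linarith [ht1 z₀], ?_⟩
        rintro ⟨u, hu, huz⟩
        exact hedge ⟨u, ⟨by linarith [hs0 z₀, hu.1], by linarith [ht1 z₀, hu.2]⟩, huz⟩
    have h1 : (M.edge e '' Icc a b)ᶜ ∈ 𝓝 (φ z₀) :=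
      (M.isClosed_image_edge e ha0.le hb1.le).isOpen_compl.mem_nhds hab
    filter_upwards [hφ.continuousAt h1, hs.continuousAt.eventually_const_lt ha,
      ht.continuousAt.eventually_lt_const hb] with z h2 h3 h4 h5
    exact h2 (image_mono (Ioo_subset_Icc_self.trans (Icc_subset_Icc h3.le h4.le)) h5)
  have : IsClopen {z | φ z ∈ M.edge e '' Ioo (s z) (t z)} := ⟨⟨hclosed⟩, hopen⟩
  rcases isClopen_iff.1 this with h | h
  · exact absurd hz (Set.ext_iff.1 h z).1
  · exact (Set.ext_iff.1 h z').2 trivial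

end GraphModel

/-! ### The spanning tree with stubs of non-tree edges attached -/

/-- The distance of the parameter `x` from the initial (`true`) or terminal (`false`) end of an
edge. -/
def endDist (σ : Bool) (x : ℝ) : ℝ := if σ then x else 1 - x

lemma endDist_endDist (σ : Bool) (x : ℝ) : endDist σ (endDist σ x) = x := by
  cases σ <;> simp [endDist]

lemma endDist_injective (σ : Bool) : Function.Injective (endDist σ) :=
  Function.LeftInverse.injective (endDist_endDist σ)

lemma endDist_mem_Ioo {σ : Bool} {x : ℝ} (hx : x ∈ Ioo (0 : ℝ) 1) : endDist σ x ∈ Ioo (0 : ℝ) 1 := by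
  cases σ
  · exact ⟨by simpa [endDist] using hx.2, by simpa [endDist] using hx.1⟩
  · exact hx

lemma endDist_true_le_iff {x y : ℝ} : endDist true x ≤ endDist true y ↔ x ≤ y := by
  simp [endDist]

lemma endDist_false_le_iff {x y : ℝ} : endDist false x ≤ endDist false y ↔ y ≤ x := by
  simp only [endDist, Bool.false_eq_true, if_false]
  constructor <;> intro h <;> linarith

namespace RootedGraph

variable {G : Type*} [TopologicalSpace G] {N S : Type*}

/-- The spanning tree, as a subspace. -/
def treeSet (R : RootedGraph G N S) : Set G :=
  range R.vertex ∪ ⋃ v, R.edge (Sum.inl v) '' Icc 0 1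

/-- By induction on depth, every vertex is joined to the root through its parent. -/
lemma isPreconnected_treeSet (R : RootedGraph G N S) : IsPreconnected R.treeSet := by
  have hedge : ∀ v, IsPreconnected (R.edge (Sum.inl v) '' Icc 0 1) := fun v =>
    isPreconnected_Icc.image _ (R.continuousOn_edge _)
  have hsub : ∀ v, R.edge (Sum.inl v) '' Icc 0 1 ⊆ R.treeSet := fun v x hx =>
    Or.inr (mem_iUnion.2 ⟨v, hx⟩)
  have hvertex : ∀ w : Option N, ∃ C ⊆ R.treeSet, R.vertex none ∈ C ∧ R.vertex w ∈ C ∧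
      IsPreconnected C := by
    intro w
    induction h : R.depth w using Nat.strong_induction_on generalizing w with
    | _ k ih =>
      cases w with
      | none => exact ⟨{R.vertex none}, by rintro _ rfl; exact Or.inl ⟨_, rfl⟩, rfl, rfl,
          isPreconnected_singleton⟩
      | some v =>
        obtain ⟨C, hC, h1, h2, h3⟩ := ih _ (h ▸ R.depth_src_lt v) _ rfl
        refine ⟨C ∪ R.edge (Sum.inl v) '' Icc 0 1, union_subset hC (hsub v), Or.inl h1,
          Or.inr ⟨1, by simp, by rw [R.edge_one, R.tgt_inl]⟩,
          h3.union (R.vertex (R.src (Sum.inl v))) h2 ⟨0, by simp, R.edge_zero _⟩ (hedge v)⟩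
  refine isPreconnected_of_forall (R.vertex none) fun y hy => ?_
  rcases hy with ⟨w, rfl⟩ | hy
  · exact hvertex w
  · obtain ⟨v, hv⟩ := mem_iUnion.1 hy
    obtain ⟨C, hC, h1, h2, h3⟩ := hvertex (some v)
    exact ⟨C ∪ R.edge (Sum.inl v) '' Icc 0 1, union_subset hC (hsub v), Or.inl h1, Or.inr hv,
      h3.union (R.vertex (some v)) h2 ⟨1, by simp, by rw [R.edge_one, R.tgt_inl]⟩ (hedge v)⟩

lemma edge_inr_notMem_treeSet (R : RootedGraph G N S) {i : S} {t : ℝ} (ht : t ∈ Ioo (0 : ℝ) 1) :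
    R.edge (Sum.inr i) t ∉ R.treeSet := by
  rintro (⟨w, hw⟩ | h)
  · exact R.edge_ne_vertex ht hw.symm
  · obtain ⟨v, x, hx, hxt⟩ := mem_iUnion.1 h
    have : R.edge (Sum.inl v) x ∈ R.edge (Sum.inr i) '' {t} := ⟨t, rfl, hxt.symm⟩
    rw [R.edge_mem_image_iff hx (by simpa using ht)] at this
    simp at this

/-- The part of the non-tree edge `k` which is at most as far from the end `σ` as `τ`. -/
def whisker (R : RootedGraph G N S) (k : S) (σ : Bool) (τ : ℝ) : Set G :=
  R.edge (Sum.inr k) '' {x ∈ Icc (0 : ℝ) 1 | endDist σ x ≤ endDist σ τ}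

/-- The stub is an interval containing the endpoint of `k` at `σ`, which is a vertex of the tree. -/
lemma isPreconnected_treeSet_union_whisker (R : RootedGraph G N S) (k : S) (σ : Bool) {τ : ℝ}
    (hτ : τ ∈ Ioo (0 : ℝ) 1) : IsPreconnected (R.treeSet ∪ R.whisker k σ τ) := by
  have hpre : IsPreconnected (R.whisker k σ τ) := by
    refine IsPreconnected.image ?_ _ ((R.continuousOn_edge _).mono (sep_subset _ _))
    have : {x ∈ Icc (0 : ℝ) 1 | endDist σ x ≤ endDist σ τ} = if σ then Icc 0 τ else Icc τ 1 := by
      ext x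
      have := hτ.1
      have := hτ.2
      cases σ <;> simp only [endDist, mem_ofPred_eq, mem_Icc, if_true, Bool.false_eq_true,
        if_false] <;> constructor <;> rintro ⟨h1, h2⟩ <;> refine ⟨?_, ?_⟩ <;> grind
    rw [this]
    split_ifs <;> exact isPreconnected_Icc
  cases σ
  · exact R.isPreconnected_treeSet.union (R.vertex (R.tgt (Sum.inr k))) (Or.inl ⟨_, rfl⟩)
      ⟨1, ⟨by simp, by simpa [endDist] using hτ.2.le⟩, R.edge_one _⟩ hpre
  · exact R.isPreconnected_treeSet.union (R.vertex (R.src (Sum.inr k))) (Or.inl ⟨_, rfl⟩)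
      ⟨0, ⟨by simp, by simpa [endDist] using hτ.1.le⟩, R.edge_zero _⟩ hpre

lemma edge_inr_mem_whisker_iff (R : RootedGraph G N S) {k i : S} {σ : Bool} {τ t : ℝ}
    (ht : t ∈ Ioo (0 : ℝ) 1) :
    R.edge (Sum.inr i) t ∈ R.whisker k σ τ ↔ i = k ∧ endDist σ t ≤ endDist σ τ := by
  constructor
  · rintro ⟨x, ⟨hx, hxτ⟩, hxt⟩
    have : R.edge (Sum.inr k) x ∈ R.edge (Sum.inr i) '' {t} := ⟨t, rfl, hxt.symm⟩
    rw [R.edge_mem_image_iff hx (by simpa using ht)] at this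
    obtain ⟨h1, rfl⟩ := this
    exact ⟨(Sum.inr.inj h1).symm, hxτ⟩
  · rintro ⟨rfl, h⟩
    exact ⟨t, ⟨Ioo_subset_Icc_self ht, h⟩, rfl⟩

end RootedGraph

/-! ### Placements on non-tree edges and slides between them -/

section Placements

variable {S ι : Type*}

/-- The position `z` lies on the arc `[s, t]` of the non-tree edge `i`. -/
def InArc (i : S) (s t : ℝ) (z : S × ℝ) : Prop := z.1 = i ∧ z.2 ∈ Icc s t

/-- Pairwise distinct positions in the interiors of non-tree edges. -/
structure IsPlacement (c : ι → S × ℝ) : Prop where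
  injective : Function.Injective c
  mem : ∀ j, (c j).2 ∈ Ioo (0 : ℝ) 1

/-- Seen from the position `(k, τ)`, the end `σ` of the edge `k` is not blocked by a token other
than `j` or by the arc `[s, t]` of the edge `i`. -/
structure IsClear (i : S) (s t : ℝ) (c : ι → S × ℝ) (j : ι) (k : S) (σ : Bool) (τ : ℝ) :
    Prop where
  token : ∀ j', j' ≠ j → (c j').1 = k → endDist σ τ < endDist σ (c j').2
  arc : k = i → ∀ x ∈ Icc s t, endDist σ τ < endDist σ x

end Placements

namespace RootedGraph

variable {G : Type*} [TopologicalSpace G] {N S ι : Type*}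

/-- The configuration of points of `G` given by positions on non-tree edges. -/
def place (R : RootedGraph G N S) (c : ι → S × ℝ) (j : ι) : G := R.edge (Sum.inr (c j).1) (c j).2

lemma place_injective (R : RootedGraph G N S) {c : ι → S × ℝ} (hc : IsPlacement c) :
    Function.Injective (R.place c) := by
  intro j j' h
  obtain ⟨h1, h2⟩ := R.edge_inj (hc.mem j) (hc.mem j') h
  exact hc.injective (Prod.ext (Sum.inr.inj h1) h2)

/-- The placement `c'` arises from `c` by moving one token through a connected set which avoids
the other tokens and the arc `[s, t]` of the edge `i`. -/
def Slide (R : RootedGraph G N S) (i : S) (s t : ℝ) (c c' : ι → S × ℝ) : Prop :=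
  IsPlacement c ∧ IsPlacement c' ∧ ∃ j, (∀ k, k ≠ j → c k = c' k) ∧ ∃ C : Set G,
    IsPreconnected C ∧ R.place c j ∈ C ∧ R.place c' j ∈ C ∧ (∀ k, k ≠ j → R.place c k ∉ C) ∧
    ∀ x ∈ Icc s t, R.edge (Sum.inr i) x ∉ C

/-- The placements `c` and `c'` are connected by slides. -/
def Reach (R : RootedGraph G N S) (i : S) (s t : ℝ) : (ι → S × ℝ) → (ι → S × ℝ) → Prop :=
  Relation.ReflTransGen (R.Slide i s t)

lemma Slide.symm {R : RootedGraph G N S} {i : S} {s t : ℝ} {c c' : ι → S × ℝ}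
    (h : R.Slide i s t c c') : R.Slide i s t c' c := by
  obtain ⟨hc, hc', j, hj, C, hC, h1, h2, h3, h4⟩ := h
  refine ⟨hc', hc, j, fun k hk => (hj k hk).symm, C, hC, h2, h1, fun k hk => ?_, h4⟩
  have := h3 k hk
  rwa [place, hj k hk] at this

lemma Reach.symm {R : RootedGraph G N S} {i : S} {s t : ℝ} {c c' : ι → S × ℝ}
    (h : R.Reach i s t c c') : R.Reach i s t c' c := by
  have : Std.Symm (R.Slide i s t (ι := ι)) := ⟨fun _ _ h => Slide.symm h⟩
  exact Std.Symm.symm (r := Relation.ReflTransGen (R.Slide i s t)) _ _ h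

/-- Avoiding a longer arc is the stronger requirement. This allows the protected arc to grow in the
induction of `reach_of_eq_on_arc`. -/
lemma Slide.mono {R : RootedGraph G N S} {i : S} {s s' t : ℝ} (hs : s' ≤ s) {c c' : ι → S × ℝ}
    (h : R.Slide i s' t c c') : R.Slide i s t c c' := by
  obtain ⟨hc, hc', j, hj, C, hC, h1, h2, h3, h4⟩ := h
  exact ⟨hc, hc', j, hj, C, hC, h1, h2, h3, fun x hx => h4 x ⟨hs.trans hx.1, hx.2⟩⟩

lemma Reach.mono {R : RootedGraph G N S} {i : S} {s s' t : ℝ} (hs : s' ≤ s) {c c' : ι → S × ℝ}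
    (h : R.Reach i s' t c c') : R.Reach i s t c c' :=
  Relation.ReflTransGen.mono (fun _ _ h => Slide.mono hs h) _ _ h

/-- The moving token starts in a set disjoint from the arc, so a token on the arc is not the one
that moves. -/
lemma Slide.inArc {R : RootedGraph G N S} {i : S} {s t : ℝ} {c c' : ι → S × ℝ}
    (h : R.Slide i s t c c') {j : ι} (hj : InArc i s t (c j)) : c' j = c j := by
  obtain ⟨-, -, k, hk, C, -, h1, -, -, h4⟩ := h
  by_cases hjk : j = k
  · subst hjk
    rw [place, hj.1] at h1
    exact absurd h1 (h4 _ hj.2)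
  · exact (hk j hjk).symm

lemma Reach.inArc {R : RootedGraph G N S} {i : S} {s t : ℝ} {c c' : ι → S × ℝ}
    (h : R.Reach i s t c c') {j : ι} (hj : InArc i s t (c j)) : c' j = c j := by
  induction h with
  | refl => rfl
  | tail _ h ih => exact (Slide.inArc h (by rwa [ih])).trans ih

lemma Reach.isPlacement {R : RootedGraph G N S} {i : S} {s t : ℝ} {c c' : ι → S × ℝ}
    (h : R.Reach i s t c c') (hc : IsPlacement c) : IsPlacement c' := by
  induction h with
  | refl => exact hc
  | tail _ h _ => exact h.2.1

variable [DecidableEq ι]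

/-- A token at an unblocked end may slide through the tree to any other unblocked end. -/
lemma slide_update (R : RootedGraph G N S) {i : S} {s t : ℝ} (hs : 0 < s) (ht : t < 1)
    {c : ι → S × ℝ} (hc : IsPlacement c) {j : ι} {σ σ' : Bool} {k' : S} {τ' : ℝ}
    (hτ' : τ' ∈ Ioo (0 : ℝ) 1) (h : IsClear i s t c j (c j).1 σ (c j).2)
    (h' : IsClear i s t c j k' σ' τ') :
    R.Slide i s t c (Function.update c j (k', τ')) := by
  have hne : ∀ k, k ≠ j → c k ≠ (k', τ') := by
    intro k hk heq
    have := h'.token k hk (by rw [heq])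
    rw [heq] at this
    exact lt_irrefl _ this
  refine ⟨hc, ⟨?_, ?_⟩, j, ?_, R.treeSet ∪ R.whisker (c j).1 σ (c j).2 ∪
    (R.treeSet ∪ R.whisker k' σ' τ'), ?_, ?_, ?_, ?_, ?_⟩
  · intro a b hab
    by_cases ha : a = j <;> by_cases hb : b = j
    · rw [ha, hb]
    · subst ha
      rw [Function.update_self, Function.update_of_ne hb] at hab
      exact absurd hab.symm (hne b hb)
    · subst hb
      rw [Function.update_self, Function.update_of_ne ha] at hab
      exact absurd hab (hne a ha)
    · rw [Function.update_of_ne ha, Function.update_of_ne hb] at hab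
      exact hc.injective hab
  · intro a
    by_cases ha : a = j
    · subst ha
      rw [Function.update_self]
      exact hτ'
    · rw [Function.update_of_ne ha]
      exact hc.mem a
  · exact fun k hk => (Function.update_of_ne hk _ _).symm
  · exact (R.isPreconnected_treeSet_union_whisker _ _ (hc.mem j)).union (R.vertex none)
      (Or.inl (Or.inl ⟨_, rfl⟩)) (Or.inl (Or.inl ⟨_, rfl⟩))
      (R.isPreconnected_treeSet_union_whisker _ _ hτ')
  · exact Or.inl (Or.inr ((R.edge_inr_mem_whisker_iff (hc.mem j)).2 ⟨rfl, le_rfl⟩))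
  · refine Or.inr (Or.inr ?_)
    rw [place, Function.update_self]
    exact (R.edge_inr_mem_whisker_iff hτ').2 ⟨rfl, le_rfl⟩
  · rintro k hk ((h1 | h1) | (h1 | h1))
    · exact R.edge_inr_notMem_treeSet (hc.mem k) h1
    · obtain ⟨h2, h3⟩ := (R.edge_inr_mem_whisker_iff (hc.mem k)).1 h1
      exact absurd (h.token k hk h2) (not_lt.2 h3)
    · exact R.edge_inr_notMem_treeSet (hc.mem k) h1
    · obtain ⟨h2, h3⟩ := (R.edge_inr_mem_whisker_iff (hc.mem k)).1 h1
      exact absurd (h'.token k hk h2) (not_lt.2 h3)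
  · intro x hx h0
    have hx' : x ∈ Ioo (0 : ℝ) 1 := ⟨hs.trans_le hx.1, hx.2.trans_lt ht⟩
    rcases h0 with (h1 | h1) | (h1 | h1)
    · exact R.edge_inr_notMem_treeSet hx' h1
    · obtain ⟨h2, h3⟩ := (R.edge_inr_mem_whisker_iff hx').1 h1
      exact absurd (h.arc h2.symm x hx) (not_lt.2 h3)
    · exact R.edge_inr_notMem_treeSet hx' h1
    · obtain ⟨h2, h3⟩ := (R.edge_inr_mem_whisker_iff hx').1 h1
      exact absurd (h'.arc h2.symm x hx) (not_lt.2 h3)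

/-- All tokens in the part of the edge `k` beyond `τ₀`, seen from the inside towards the end `σ`,
can be moved to another end of an edge. -/
lemma exists_reach_evacuate [Finite ι] (R : RootedGraph G N S) {i : S} {s t : ℝ} (hs : 0 < s)
    (ht : t < 1) {k k' : S} {σ σ' : Bool} {τ₀ θ : ℝ} (hθ : θ ∈ Ioo (0 : ℝ) 1)
    (harc : k = i → ∀ x ∈ Icc s t, endDist σ τ₀ ≤ endDist σ x)
    (harc' : k' = i → ∀ x ∈ Icc s t, endDist σ' θ ≤ endDist σ' x)
    (hdisj : k' = k → ∀ x, endDist σ' x < endDist σ' θ → endDist σ τ₀ ≤ endDist σ x)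
    {c : ι → S × ℝ} (hc : IsPlacement c) :
    ∃ c', R.Reach i s t c c' ∧ (∀ j, (c' j).1 = k → endDist σ τ₀ ≤ endDist σ (c' j).2) ∧
      ∀ j, c' j = c j ∨ ((c j).1 = k ∧ endDist σ (c j).2 < endDist σ τ₀ ∧
        (c' j).1 = k' ∧ endDist σ' (c' j).2 < endDist σ' θ) := by
  have := Fintype.ofFinite ι
  classical
  induction hn : (Finset.univ.filter fun j => (c j).1 = k ∧
    endDist σ (c j).2 < endDist σ τ₀).card using Nat.strong_induction_on generalizing c with
  | _ n ih =>
    rcases (Finset.univ.filter fun j => (c j).1 = k ∧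
      endDist σ (c j).2 < endDist σ τ₀).eq_empty_or_nonempty with hemp | hne
    · refine ⟨c, Relation.ReflTransGen.refl, fun j hj => ?_, fun j => Or.inl rfl⟩
      by_contra hcon
      exact Finset.notMem_empty j (hemp ▸ by simp [hj, not_le.1 hcon])
    -- The token nearest to the end `σ` has a free way out; it is parked so close to the end `σ'` of
    -- `k'` that neither a token nor `θ` is nearer.
    · obtain ⟨j, hj, hmin⟩ := Finset.exists_min_image _ (fun j => endDist σ (c j).2) hne
      simp only [Finset.mem_filter, Finset.mem_univ, true_and] at hj hmin
      obtain ⟨δ, hδ0, hδθ, hδ⟩ : ∃ δ > 0, δ < endDist σ' θ ∧ ∀ j', δ < endDist σ' (c j').2 := by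
        have hpos : ∀ᶠ δ in 𝓝[>] (0 : ℝ), δ < endDist σ' θ ∧ ∀ j', δ < endDist σ' (c j').2 := by
          refine nhdsWithin_le_nhds ((eventually_lt_nhds (endDist_mem_Ioo hθ).1).and
            (eventually_all.2 fun j' => eventually_lt_nhds (endDist_mem_Ioo (hc.mem j')).1))
        obtain ⟨δ, h1, h2⟩ := (hpos.and self_mem_nhdsWithin).exists
        exact ⟨δ, h2, h1.1, h1.2⟩
      have hδ1 : δ < 1 := hδθ.trans (endDist_mem_Ioo hθ).2
      have hslide := R.slide_update hs ht hc (j := j) (σ := σ) (σ' := σ') (k' := k')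
        (τ' := endDist σ' δ) (endDist_mem_Ioo ⟨hδ0, hδ1⟩)
        ⟨fun j' hj' hk => by
          rw [hj.1] at hk
          by_contra hcon
          rw [not_lt] at hcon
          have := hmin j' ⟨hk, hcon.trans_lt hj.2⟩
          exact hj' (hc.injective (Prod.ext (hk.trans hj.1.symm)
            (endDist_injective σ (le_antisymm hcon this)))),
          fun hk x hx => hj.2.trans_le (harc (hj.1 ▸ hk) x hx)⟩
        ⟨fun j' _ _ => by rw [endDist_endDist]; exact hδ j',
          fun hk x hx => by rw [endDist_endDist]; exact hδθ.trans_le (harc' hk x hx)⟩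
      set d := Function.update c j (k', endDist σ' δ) with hd
      have hdj : d j = (k', endDist σ' δ) := Function.update_self ..
      have hdne : ∀ j', j' ≠ j → d j' = c j' := fun j' h => Function.update_of_ne h ..
      have hdjk : ¬ ((d j).1 = k ∧ endDist σ (d j).2 < endDist σ τ₀) := by
        rintro ⟨h1, h2⟩
        rw [hdj] at h1 h2
        exact absurd h2 (not_lt.2 (hdisj h1 _ (by rwa [endDist_endDist])))
      have hlt : (Finset.univ.filter fun j => (d j).1 = k ∧
          endDist σ (d j).2 < endDist σ τ₀).card < n := by
        rw [← hn]
        refine Finset.card_lt_card ⟨fun a ha => ?_, fun hsub => ?_⟩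
        · simp only [Finset.mem_filter, Finset.mem_univ, true_and] at ha ⊢
          by_cases haj : a = j
          · rw [haj]
            exact hj
          · rwa [hdne a haj] at ha
        · have := hsub (show j ∈ _ by simpa using hj)
          simp only [Finset.mem_filter, Finset.mem_univ, true_and] at this
          exact hdjk this
      obtain ⟨c', h1, h2, h3⟩ := ih _ hlt hslide.2.1 rfl
      refine ⟨c', Relation.ReflTransGen.head hslide h1, h2, fun a => ?_⟩
      by_cases haj : a = j
      · subst haj
        refine Or.inr ⟨hj.1, hj.2, ?_⟩
        rcases h3 a with h4 | ⟨h4, h5, -⟩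
        · rw [h4, hdj]
          exact ⟨rfl, by rwa [endDist_endDist]⟩
        · exact absurd ⟨h4, h5⟩ hdjk
      · rw [← hdne a haj]
        exact h3 a

/-- Any token outside the arc `[s, t]` of the edge `i` can be brought next to it. -/
lemma exists_reach_bring [Finite ι] (R : RootedGraph G N S) {i k : S} (hki : k ≠ i) {s t : ℝ}
    (hs : 0 < s) (hst : s ≤ t) (ht : t < 1) {c : ι → S × ℝ} (hc : IsPlacement c) {y : ι}
    (hy : ¬ InArc i s t (c y)) :
    ∃ c', R.Reach i s t c c' ∧ c' y = (i, s / 2) ∧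
      ∀ j, j ≠ y → InArc i (s / 2) t (c' j) → InArc i s t (c j) := by
  have ht0 : t ∈ Ioo (0 : ℝ) 1 := ⟨hs.trans_le hst, ht⟩
  -- The part of `i` before `s` is emptied into the part after `t`, and that part is then emptied
  -- into `k`. Afterwards `i` carries only the tokens on the arc.
  obtain ⟨c₁, hr₁, h₁, h₁'⟩ := R.exists_reach_evacuate (i := i) hs ht (k := i) (k' := i) (σ := true)
    (σ' := false) (τ₀ := s) (θ := t) ht0 (fun _ x hx => endDist_true_le_iff.2 hx.1)
    (fun _ x hx => endDist_false_le_iff.2 hx.2)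
    (fun _ x hx => by simp only [endDist, Bool.false_eq_true, if_false, if_true] at *; linarith) hc
  have hc₁ := hr₁.isPlacement hc
  obtain ⟨c₂, hr₂, h₂, h₂'⟩ := R.exists_reach_evacuate (i := i) hs ht (k := i) (k' := k) (σ := false)
    (σ' := true) (τ₀ := t) (θ := t) ht0 (fun _ x hx => endDist_false_le_iff.2 hx.2)
    (fun h => absurd h hki) (fun h => absurd h hki) hc₁
  have hc₂ := hr₂.isPlacement hc₁
  have hr₁₂ := hr₁.trans hr₂
  have hi₂ : ∀ j, (c₂ j).1 = i → InArc i s t (c₂ j) := by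
    intro j hj
    refine ⟨hj, ?_, ?_⟩
    · rcases h₂' j with h | ⟨-, -, h, -⟩
      · rw [h] at hj ⊢
        exact endDist_true_le_iff.1 (h₁ j hj)
      · exact absurd (h.symm.trans hj) hki
    · exact endDist_false_le_iff.1 (h₂ j hj)
  have hback : ∀ {d : ι → S × ℝ}, R.Reach i s t c d → ∀ j, InArc i s t (d j) →
      InArc i s t (c j) := by
    intro d hd j hj
    have := hd.symm.inArc hj
    rwa [this]
  have hyi : (c₂ y).1 ≠ i := fun h => hy (hback hr₁₂ y (hi₂ y h))
  -- The tokens between `y` and the initial end of its edge are moved to the far side of the arc on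
  -- `i`. Then `y` can leave and enter `i` at its empty initial end.
  obtain ⟨c₃, hr₃, h₃, h₃'⟩ := R.exists_reach_evacuate (i := i) hs ht (k := (c₂ y).1) (k' := i) (σ := true)
    (σ' := false) (τ₀ := (c₂ y).2) (θ := t) ht0 (fun h => absurd h hyi)
    (fun _ x hx => endDist_false_le_iff.2 hx.2) (fun h => absurd h.symm hyi) hc₂
  have hc₃ := hr₃.isPlacement hc₂
  have hy₃ : c₃ y = c₂ y := by
    rcases h₃' y with h | ⟨-, h, -⟩
    · exact h
    · exact absurd h (lt_irrefl _)
  have hi₃ : ∀ j, (c₃ j).1 = i → s ≤ (c₃ j).2 := by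
    intro j hj
    rcases h₃' j with h | ⟨-, -, -, h⟩
    · rw [h] at hj ⊢
      exact (hi₂ j hj).2.1
    · simp only [endDist, Bool.false_eq_true, if_false] at h
      linarith
  have hslide := R.slide_update hs ht hc₃ (j := y) (σ := true) (σ' := true) (k' := i)
    (τ' := s / 2) ⟨by linarith, by linarith⟩
    ⟨fun j hj hk => by
      rw [hy₃] at hk ⊢
      refine lt_of_le_of_ne (h₃ j hk) fun heq => hj (hc₃.injective ?_)
      rw [hy₃]
      exact Prod.ext hk (endDist_injective true heq.symm),
      fun h => absurd (hy₃ ▸ h) hyi⟩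
    ⟨fun j _ hk => by
      have := hi₃ j hk
      simp only [endDist, if_true]
      linarith,
      fun _ x hx => by
      have := hx.1
      simp only [endDist, if_true]
      linarith⟩
  have hr := (hr₁₂.trans hr₃).tail hslide
  refine ⟨_, hr, Function.update_self .., fun j hj h => hback hr j ?_⟩
  rw [Function.update_of_ne hj] at h ⊢
  exact ⟨h.1, hi₃ j h.1, h.2.2⟩

/-- Placements which agree on the tokens in an arc are connected by slides avoiding that arc. -/
theorem reach_of_eq_on_arc [Finite ι] (R : RootedGraph G N S) {i k : S} (hki : k ≠ i) {s t : ℝ}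
    (hs : 0 < s) (hst : s ≤ t) (ht : t < 1) {c c' : ι → S × ℝ} (hc : IsPlacement c)
    (hc' : IsPlacement c') (h : ∀ j, InArc i s t (c j) ∨ InArc i s t (c' j) → c j = c' j) :
    R.Reach i s t c c' := by
  have := Fintype.ofFinite ι
  classical
  induction hn : (Finset.univ.filter fun j => ¬ InArc i s t (c j)).card
    using Nat.strong_induction_on generalizing s c c' with
  | _ n ih =>
    by_cases hall : ∀ j, InArc i s t (c j)
    · obtain rfl : c = c' := funext fun j => h j (Or.inl (hall j))
      exact Relation.ReflTransGen.refl
    push Not at hall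
    obtain ⟨y, hy⟩ := hall
    have hy' : ¬ InArc i s t (c' y) := fun h1 => hy (by rwa [h y (Or.inr h1)])
    -- Bringing `y` to `s / 2` in both placements makes them agree on the longer arc `[s / 2, t]`,
    -- outside of which there is one token fewer.
    obtain ⟨d, hr, hdy, hd⟩ := R.exists_reach_bring hki hs hst ht hc hy
    obtain ⟨d', hr', hdy', hd'⟩ := R.exists_reach_bring hki hs hst ht hc' hy'
    have key : R.Reach i (s / 2) t d d' := by
      refine ih _ ?_ (by linarith) (by linarith) (hr.isPlacement hc) (hr'.isPlacement hc') ?_ rfl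
      · rw [← hn]
        refine Finset.card_lt_card ⟨fun a ha => ?_, fun hsub => ?_⟩
        · simp only [Finset.mem_filter, Finset.mem_univ, true_and] at ha ⊢
          intro h1
          refine ha ?_
          rw [hr.inArc h1]
          exact ⟨h1.1, by linarith [h1.2.1], h1.2.2⟩
        · have := hsub (show y ∈ _ by simpa using hy)
          simp only [Finset.mem_filter, Finset.mem_univ, true_and, hdy] at this
          exact this ⟨rfl, le_rfl, by linarith⟩
      · intro j hj
        by_cases hjy : j = y
        · rw [hjy, hdy, hdy']
        · have hcj : InArc i s t (c j) ∧ InArc i s t (c' j) := by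
            rcases hj with h1 | h1
            · have := hd j hjy h1
              exact ⟨this, h j (Or.inl this) ▸ this⟩
            · have := hd' j hjy h1
              exact ⟨h j (Or.inr this) ▸ this, this⟩
          rw [hr.inArc hcj.1, hr'.inArc hcj.2, h j (Or.inl hcj.1)]
    exact (hr.trans (key.mono (by linarith))).trans hr'.symm

end RootedGraph

/-! ### Forced pairs of adjacent tokens -/

/-- Distinct parameters in `(0, 1)`, ordered compatibly with a given priority function. -/
lemma exists_injective_mem_Ioo_of_priority {ι : Type*} [Finite ι] (pr : ι → ℕ) :
    ∃ ρ : ι → ℝ, Function.Injective ρ ∧ (∀ k, ρ k ∈ Ioo (0 : ℝ) 1) ∧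
      ∀ k k', pr k < pr k' → ρ k < ρ k' := by
  obtain ⟨n, ⟨e⟩⟩ := Finite.exists_equiv_fin ι
  -- Ties in priority are broken by the enumeration `e`, whose values are below `n`.
  let val : ι → ℕ := fun k => pr k * n + e k
  have hval : ∀ k k', pr k < pr k' → val k < val k' := by
    intro k k' h
    have h1 : (pr k + 1) * n ≤ pr k' * n := Nat.mul_le_mul_right n h
    have h2 := (e k).2
    simp only [val]
    nlinarith
  have hinj : Function.Injective val := by
    intro k k' h
    rcases lt_trichotomy (pr k) (pr k') with h1 | h1 | h1
    · exact absurd h (hval _ _ h1).ne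
    · simp only [val, h1, Nat.add_left_cancel_iff] at h
      exact e.injective (Fin.ext h)
    · exact absurd h (hval _ _ h1).ne'
  let ψ : ℕ → ℝ := fun a => 1 - 1 / ((a : ℝ) + 2)
  have hψ : StrictMono ψ := by
    intro a b hab
    have : (a : ℝ) < b := by exact_mod_cast hab
    have : 1 / ((b : ℝ) + 2) < 1 / ((a : ℝ) + 2) :=
      one_div_lt_one_div_of_lt (by positivity) (by linarith)
    simp only [ψ]
    linarith
  refine ⟨fun k => ψ (val k), hψ.injective.comp hinj, fun k => ⟨?_, ?_⟩,
    fun k k' h => hψ (hval k k' h)⟩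
  · have : 1 / ((val k : ℝ) + 2) < 1 := by
      rw [div_lt_one (by positivity)]
      have : (0 : ℝ) ≤ val k := Nat.cast_nonneg _
      linarith
    simp only [ψ]
    linarith
  · have : 0 < 1 / ((val k : ℝ) + 2) := by positivity
    simp only [ψ]
    linarith

/-- A function on tuples which is continuous on configurations and avoids all entries. -/
structure AvoidsTokens {ι G : Type*} [TopologicalSpace G] (F : (ι → G) → G) : Prop where
  continuousOn : ContinuousOn F {x | Function.Injective x}
  ne : ∀ x, Function.Injective x → ∀ i, F x ≠ x i

namespace RootedGraph

variable {G : Type*} [TopologicalSpace G] {N S ι : Type*}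

/-- Whenever the tokens `u < v` are adjacent on the edge `i` and all other tokens lie on non-tree
edges, the value of `F` lies between `u` and `v`. -/
def Forced (R : RootedGraph G N S) (F : (ι → G) → G) (i : S) (u v : ι) : Prop :=
  ∀ c : ι → S × ℝ, IsPlacement c → (c u).1 = i → (c v).1 = i → (c u).2 < (c v).2 →
    (∀ j, j ≠ u → j ≠ v → ¬ InArc i (c u).2 (c v).2 (c j)) →
    F (R.place c) ∈ R.edge (Sum.inr i) '' Ioo (c u).2 (c v).2

/-- In a connected family of configurations the tokens `u` and `v` mark the ends of the arc. Since
`F` never hits them, `mem_arc_of_preconnected` applies. -/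
lemma mem_arc_of_isPreconnected [T2Space G] [Finite N] [Finite S] (R : RootedGraph G N S)
    {F : (ι → G) → G} (hF : AvoidsTokens F) {Y : Type*} [TopologicalSpace Y] {C : Set Y}
    (hC : IsPreconnected C) {x : Y → ι → G} (hx : ContinuousOn x C)
    (hinj : ∀ y ∈ C, Function.Injective (x y)) {i : S} {u v : ι} {s t : Y → ℝ}
    (hs : ContinuousOn s C) (ht : ContinuousOn t C) (hs0 : ∀ y ∈ C, 0 < s y)
    (hst : ∀ y ∈ C, s y < t y) (ht1 : ∀ y ∈ C, t y < 1)
    (hu : ∀ y ∈ C, x y u = R.edge (Sum.inr i) (s y))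
    (hv : ∀ y ∈ C, x y v = R.edge (Sum.inr i) (t y)) {y y' : Y} (hy : y ∈ C) (hy' : y' ∈ C)
    (h : F (x y) ∈ R.edge (Sum.inr i) '' Ioo (s y) (t y)) :
    F (x y') ∈ R.edge (Sum.inr i) '' Ioo (s y') (t y') := by
  have := isPreconnected_iff_preconnectedSpace.1 hC
  have hcont : Continuous fun z : C => F (x z) :=
    continuousOn_iff_continuous_domRestrict.1 (hF.continuousOn.comp hx hinj)
  exact R.mem_arc_of_preconnected (Sum.inr i) hcont
    (continuousOn_iff_continuous_domRestrict.1 hs) (continuousOn_iff_continuous_domRestrict.1 ht)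
    (fun z => hs0 z z.2) (fun z => hst z z.2) (fun z => ht1 z z.2)
    (fun z => by have := hF.ne _ (hinj z z.2) u; rwa [hu z z.2] at this)
    (fun z => by have := hF.ne _ (hinj z z.2) v; rwa [hv z z.2] at this)
    (z := ⟨y, hy⟩) (z' := ⟨y', hy'⟩) h

/-- No slide moves `u` or `v`, as both lie on the protected arc. Each slide is therefore a connected
family of configurations with a fixed arc. -/
lemma Reach.mem_arc [T2Space G] [Finite N] [Finite S] {R : RootedGraph G N S}
    {F : (ι → G) → G} (hF : AvoidsTokens F) {i : S} {s t : ℝ} (hs : 0 < s) (hst : s < t)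
    (ht : t < 1) {u v : ι} {c c' : ι → S × ℝ} (hr : R.Reach i s t c c') (hu : c u = (i, s))
    (hv : c v = (i, t)) (h : F (R.place c) ∈ R.edge (Sum.inr i) '' Ioo s t) :
    F (R.place c') ∈ R.edge (Sum.inr i) '' Ioo s t := by
  classical
  have hiu : InArc i s t (c u) := by rw [hu]; exact ⟨rfl, le_rfl, hst.le⟩
  have hiv : InArc i s t (c v) := by rw [hv]; exact ⟨rfl, hst.le, le_rfl⟩
  induction hr with
  | refl => exact h
  | @tail d d' hcd hdd' ih =>
    have hdu : d u = (i, s) := (Reach.inArc hcd hiu).trans hu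
    have hdv : d v = (i, t) := (Reach.inArc hcd hiv).trans hv
    obtain ⟨hd, hd', j, hj, C, hC, h1, h2, h3, h4⟩ := hdd'
    have hju : u ≠ j := by
      rintro rfl
      rw [place, hdu] at h1
      exact h4 s ⟨le_rfl, hst.le⟩ h1
    have hjv : v ≠ j := by
      rintro rfl
      rw [place, hdv] at h1
      exact h4 t ⟨hst.le, le_rfl⟩ h1
    have hx : ∀ y ∈ C, Function.Injective (Function.update (R.place d) j y) := by
      intro y hy a b hab
      by_cases ha : a = j <;> by_cases hb : b = j
      · rw [ha, hb]
      · rw [ha, Function.update_self, Function.update_of_ne hb] at hab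
        exact absurd (hab ▸ hy) (h3 b hb)
      · rw [hb, Function.update_self, Function.update_of_ne ha] at hab
        exact absurd (hab ▸ hy) (h3 a ha)
      · rw [Function.update_of_ne ha, Function.update_of_ne hb] at hab
        exact R.place_injective hd hab
    have key := R.mem_arc_of_isPreconnected hF hC (x := fun y => Function.update (R.place d) j y)
      (Continuous.continuousOn (by fun_prop)) hx (i := i) (u := u) (v := v)
      (s := fun _ => s) (t := fun _ => t) continuousOn_const continuousOn_const
      (fun _ _ => hs) (fun _ _ => hst) (fun _ _ => ht)
      (fun y _ => by rw [Function.update_of_ne hju, place, hdu])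
      (fun y _ => by rw [Function.update_of_ne hjv, place, hdv]) h1 h2
      (by rw [Function.update_eq_self]; exact ih)
    convert key using 2
    funext k
    by_cases hk : k = j
    · rw [hk, Function.update_self]
    · rw [Function.update_of_ne hk, place, place, hj k hk]

/-- A single configuration with the value between two adjacent tokens determines all such
configurations. -/
lemma forced_of_mem [T2Space G] [Finite N] [Finite S] [Finite ι] (R : RootedGraph G N S)
    {F : (ι → G) → G} (hF : AvoidsTokens F) {i k : S} (hki : k ≠ i) {u v : ι}
    {c : ι → S × ℝ} (hc : IsPlacement c) (hu : (c u).1 = i) (hv : (c v).1 = i)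
    (huv : (c u).2 < (c v).2) (hno : ∀ j, j ≠ u → j ≠ v → ¬ InArc i (c u).2 (c v).2 (c j))
    (hmem : F (R.place c) ∈ R.edge (Sum.inr i) '' Ioo (c u).2 (c v).2) : R.Forced F i u v := by
  classical
  intro c' hc' hu' hv' huv' hno'
  obtain ⟨ρ, hρ, hρ1, -⟩ := exists_injective_mem_Ioo_of_priority (fun _ : ι => 0)
  have hne : v ≠ u := by
    rintro rfl
    exact lt_irrefl _ huv
  -- In this normal form all other tokens are parked on `k`. Slides bring `c` and `c'` into normal
  -- form, and a linear motion of `u` and `v` joins the two normal forms.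
  let e : ℝ → ℝ → ι → S × ℝ := fun s t j => if j = u then (i, s) else if j = v then (i, t) else
    (k, ρ j)
  have heu : ∀ s t, e s t u = (i, s) := fun s t => if_pos rfl
  have hev : ∀ s t, e s t v = (i, t) := fun s t => (if_neg hne).trans (if_pos rfl)
  have hej : ∀ s t j, j ≠ u → j ≠ v → e s t j = (k, ρ j) := fun s t j h1 h2 =>
    (if_neg h1).trans (if_neg h2)
  have hplace : ∀ s t, s ∈ Ioo (0 : ℝ) 1 → t ∈ Ioo (0 : ℝ) 1 → s < t → IsPlacement (e s t) := by
    intro s t hs ht hst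
    refine ⟨fun a b hab => ?_, fun a => ?_⟩
    · by_cases ha : a = u <;> by_cases hb : b = u <;> by_cases ha' : a = v <;>
        by_cases hb' : b = v <;> simp_all only [e, if_true, if_false] <;> grind
    · by_cases ha : a = u
      · rw [ha, heu]
        exact hs
      by_cases ha' : a = v
      · rw [ha', hev]
        exact ht
      · rw [hej s t a ha ha']
        exact hρ1 a
  have hreach : ∀ d : ι → S × ℝ, IsPlacement d → (d u).1 = i → (d v).1 = i →
      (d u).2 < (d v).2 → (∀ j, j ≠ u → j ≠ v → ¬ InArc i (d u).2 (d v).2 (d j)) →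
      R.Reach i (d u).2 (d v).2 d (e (d u).2 (d v).2) := by
    intro d hd h1 h2 h3 h4
    refine R.reach_of_eq_on_arc hki (hd.mem u).1 h3.le (hd.mem v).2 hd
      (hplace _ _ (hd.mem u) (hd.mem v) h3) fun j hj => ?_
    by_cases ha : j = u
    · rw [ha, heu]
      exact Prod.ext h1 rfl
    by_cases ha' : j = v
    · rw [ha', hev]
      exact Prod.ext h2 rfl
    rcases hj with hj | hj
    · exact absurd hj (h4 j ha ha')
    · rw [hej _ _ j ha ha'] at hj
      exact absurd hj.1 hki
  have hfirst := Reach.mem_arc hF (hc.mem u).1 huv (hc.mem v).2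
    (hreach c hc hu hv huv hno) (Prod.ext hu rfl) (Prod.ext hv rfl) hmem
  let s : ℝ → ℝ := fun y => (1 - y) * (c u).2 + y * (c' u).2
  let t : ℝ → ℝ := fun y => (1 - y) * (c v).2 + y * (c' v).2
  have hs : ∀ y ∈ Icc (0 : ℝ) 1, s y ∈ Ioo (0 : ℝ) 1 := fun y hy =>
    convex_Ioo (0 : ℝ) 1 (hc.mem u) (hc'.mem u) (by linarith [hy.2]) hy.1 (by ring)
  have ht : ∀ y ∈ Icc (0 : ℝ) 1, t y ∈ Ioo (0 : ℝ) 1 := fun y hy =>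
    convex_Ioo (0 : ℝ) 1 (hc.mem v) (hc'.mem v) (by linarith [hy.2]) hy.1 (by ring)
  have hst : ∀ y ∈ Icc (0 : ℝ) 1, s y < t y := by
    intro y hy
    have h1 : 0 ≤ 1 - y := by linarith [hy.2]
    rcases eq_or_lt_of_le hy.1 with h | h
    · simp only [s, t, ← h]
      linarith
    · have := mul_lt_mul_of_pos_left huv' h
      have := mul_le_mul_of_nonneg_left huv.le h1
      simp only [s, t]
      linarith
  have hsc : Continuous s := by fun_prop
  have htc : Continuous t := by fun_prop
  have hmid := R.mem_arc_of_isPreconnected hF (isPreconnected_Icc (a := (0 : ℝ)) (b := 1))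
    (x := fun y => R.place (e (s y) (t y))) (i := i) (u := u) (v := v) (s := s) (t := t)
    (continuousOn_pi.2 fun j => by
      by_cases ha : j = u
      · subst ha
        simp only [place, heu]
        exact (R.continuousOn_edge _).comp hsc.continuousOn fun y hy =>
          Ioo_subset_Icc_self (hs y hy)
      by_cases ha' : j = v
      · subst ha'
        simp only [place, hev]
        exact (R.continuousOn_edge _).comp htc.continuousOn fun y hy =>
          Ioo_subset_Icc_self (ht y hy)
      · simp only [place, hej _ _ j ha ha']
        exact continuousOn_const)
    (fun y hy => R.place_injective (hplace _ _ (hs y hy) (ht y hy) (hst y hy)))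
    hsc.continuousOn htc.continuousOn (fun y hy => (hs y hy).1) hst (fun y hy => (ht y hy).2)
    (fun y _ => by rw [place, heu]) (fun y _ => by rw [place, hev])
    (y := 0) (y' := 1) (by simp) (by simp) (by simpa [s, t] using hfirst)
  have hs1 : s 1 = (c' u).2 := by simp [s]
  have ht1 : t 1 = (c' v).2 := by simp [t]
  rw [hs1, ht1] at hmid
  exact Reach.mem_arc hF (hc'.mem u).1 huv' (hc'.mem v).2
    (hreach c' hc' hu' hv' huv' hno').symm (heu _ _) (hev _ _) hmid

end RootedGraph

/-! ### One token moving in the tree cut open by the others -/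

/-- The tokens other than `m` sit at distinct positions on the non-tree edges, and `lo i`, `hi i`
are the first and the last of them on the edge `i`. -/
structure IsCut {S ι : Type*} (c : ι → S × ℝ) (m : ι) (lo hi : S → ι) : Prop where
  mem : ∀ j, j ≠ m → (c j).2 ∈ Ioo (0 : ℝ) 1
  inj : ∀ j, j ≠ m → ∀ j', j' ≠ m → c j = c j' → j = j'
  lo_ne : ∀ i, lo i ≠ m
  lo_fst : ∀ i, (c (lo i)).1 = i
  lo_le : ∀ i j, j ≠ m → (c j).1 = i → (c (lo i)).2 ≤ (c j).2
  hi_ne : ∀ i, hi i ≠ m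
  hi_fst : ∀ i, (c (hi i)).1 = i
  le_hi : ∀ i j, j ≠ m → (c j).1 = i → (c j).2 ≤ (c (hi i)).2

lemma exists_isCut {S ι : Type*} [Finite ι] {c : ι → S × ℝ} {m : ι}
    (hmem : ∀ j, j ≠ m → (c j).2 ∈ Ioo (0 : ℝ) 1)
    (hinj : ∀ j, j ≠ m → ∀ j', j' ≠ m → c j = c j' → j = j')
    (hsurj : ∀ i, ∃ j, j ≠ m ∧ (c j).1 = i) : ∃ lo hi, IsCut c m lo hi := by
  classical
  have := Fintype.ofFinite ι
  have hne : ∀ i, (Finset.univ.filter fun j => j ≠ m ∧ (c j).1 = i).Nonempty := fun i => by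
    obtain ⟨j, hj⟩ := hsurj i
    exact ⟨j, by simpa using hj⟩
  choose lo hlo hlo' using fun i => Finset.exists_min_image _ (fun j => (c j).2) (hne i)
  choose hi hhi hhi' using fun i => Finset.exists_max_image _ (fun j => (c j).2) (hne i)
  simp only [Finset.mem_filter, Finset.mem_univ, true_and] at hlo hlo' hhi hhi'
  exact ⟨lo, hi, hmem, hinj, fun i => (hlo i).1, fun i => (hlo i).2,
    fun i j h1 h2 => hlo' i j ⟨h1, h2⟩, fun i => (hhi i).1, fun i => (hhi i).2,
    fun i j h1 h2 => hhi' i j ⟨h1, h2⟩⟩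

namespace IsCut

variable {S ι : Type*} {c : ι → S × ℝ} {m : ι} {lo hi : S → ι}

lemma lo_pos (h : IsCut c m lo hi) (i : S) : 0 < (c (lo i)).2 := (h.mem _ (h.lo_ne i)).1

lemma lo_le_hi (h : IsCut c m lo hi) (i : S) : (c (lo i)).2 ≤ (c (hi i)).2 :=
  h.lo_le i _ (h.hi_ne i) (h.hi_fst i)

lemma hi_lt_one (h : IsCut c m lo hi) (i : S) : (c (hi i)).2 < 1 := (h.mem _ (h.hi_ne i)).2

lemma lo_eq (h : IsCut c m lo hi) {i : S} {u : ι} (hu : u ≠ m) (hui : (c u).1 = i)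
    (hle : ∀ j, j ≠ m → (c j).1 = i → (c u).2 ≤ (c j).2) : lo i = u :=
  h.inj _ (h.lo_ne i) _ hu (Prod.ext ((h.lo_fst i).trans hui.symm)
    (le_antisymm (h.lo_le i u hu hui) (hle _ (h.lo_ne i) (h.lo_fst i))))

lemma hi_eq (h : IsCut c m lo hi) {i : S} {u : ι} (hu : u ≠ m) (hui : (c u).1 = i)
    (hle : ∀ j, j ≠ m → (c j).1 = i → (c j).2 ≤ (c u).2) : hi i = u :=
  h.inj _ (h.hi_ne i) _ hu (Prod.ext ((h.hi_fst i).trans hui.symm)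
    (le_antisymm (hle _ (h.hi_ne i) (h.hi_fst i)) (h.le_hi i u hu hui)))

lemma isPlacement_update [DecidableEq ι] (h : IsCut c m lo hi) {i : S} {t : ℝ}
    (ht : t ∈ Ioo (0 : ℝ) 1) (hout : t ∉ Icc (c (lo i)).2 (c (hi i)).2) :
    IsPlacement (Function.update c m (i, t)) := by
  have hne : ∀ j, j ≠ m → c j ≠ (i, t) := by
    intro j hj heq
    have h1 := h.lo_le i j hj (by rw [heq])
    have h2 := h.le_hi i j hj (by rw [heq])
    rw [heq] at h1 h2
    exact hout ⟨h1, h2⟩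
  refine ⟨fun a b hab => ?_, fun a => ?_⟩
  · by_cases ha : a = m <;> by_cases hb : b = m
    · rw [ha, hb]
    · rw [ha, Function.update_self, Function.update_of_ne hb] at hab
      exact absurd hab.symm (hne b hb)
    · rw [hb, Function.update_self, Function.update_of_ne ha] at hab
      exact absurd hab (hne a ha)
    · rw [Function.update_of_ne ha, Function.update_of_ne hb] at hab
      exact h.inj a ha b hb hab
  · by_cases ha : a = m
    · rw [ha, Function.update_self]
      exact ht
    · rw [Function.update_of_ne ha]
      exact h.mem a ha

end IsCut

namespace RootedGraph

variable {G : Type*} [TopologicalSpace G] {N S ι : Type*}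

/-- Every point lies in the spanning tree or on a stub attached to it. -/
lemma isPreconnected_cutTree (R : RootedGraph G N S) {p q : S → ℝ} (hp : ∀ i, 0 < p i)
    (hq : ∀ i, q i < 1) : IsPreconnected (R.cutTree p q) := by
  have htree : R.treeSet ⊆ R.cutTree p q := by
    rintro x (⟨w, rfl⟩ | hx)
    · exact R.vertex_mem_cutTree hp hq w
    · obtain ⟨v, t, ht, rfl⟩ := mem_iUnion.1 hx
      exact R.edge_inl_mem_cutTree hp hq v ht
  have hroot : R.vertex none ∈ R.treeSet := Or.inl ⟨_, rfl⟩
  refine isPreconnected_of_forall (R.vertex none) fun y hy => ?_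
  rcases R.exists_eq y with ⟨w, rfl⟩ | ⟨v | i, t, ht, rfl⟩
  · exact ⟨_, htree, hroot, Or.inl ⟨_, rfl⟩, R.isPreconnected_treeSet⟩
  · exact ⟨_, htree, hroot, Or.inr (mem_iUnion.2 ⟨v, t, Ioo_subset_Icc_self ht, rfl⟩),
      R.isPreconnected_treeSet⟩
  · have hself : ∀ σ, R.edge (Sum.inr i) t ∈ R.whisker i σ t := fun σ =>
      (R.edge_inr_mem_whisker_iff ht).2 ⟨rfl, le_rfl⟩
    rw [R.edge_inr_mem_cutTree_iff hp hq i (Ioo_subset_Icc_self ht)] at hy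
    rcases lt_or_ge t (p i) with h | h
    · refine ⟨_, union_subset htree ?_, Or.inl hroot, Or.inr (hself true),
        R.isPreconnected_treeSet_union_whisker i true ht⟩
      rintro _ ⟨x, ⟨hx, hxt⟩, rfl⟩
      rw [endDist_true_le_iff] at hxt
      exact (R.edge_inr_mem_cutTree_iff hp hq i hx).2 fun h' => by linarith [h'.1]
    · have h1 : q i < t := not_le.1 fun h' => hy ⟨h, h'⟩
      refine ⟨_, union_subset htree ?_, Or.inl hroot, Or.inr (hself false),
        R.isPreconnected_treeSet_union_whisker i false ht⟩
      rintro _ ⟨x, ⟨hx, hxt⟩, rfl⟩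
      rw [endDist_false_le_iff] at hxt
      exact (R.edge_inr_mem_cutTree_iff hp hq i hx).2 fun h' => by linarith [h'.2]

variable [DecidableEq ι]

/-- The value of `F` as a function of the position of the token `m`. -/
def moving (R : RootedGraph G N S) (F : (ι → G) → G) (c : ι → S × ℝ) (m : ι) (y : G) : G :=
  F (Function.update (R.place c) m y)

lemma moving_edge (R : RootedGraph G N S) (F : (ι → G) → G) (c : ι → S × ℝ) (m : ι) (i : S)
    (t : ℝ) : R.moving F c m (R.edge (Sum.inr i) t) =
      F (R.place (Function.update c m (i, t))) := by
  rw [moving]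
  congr 1
  funext k
  by_cases hk : k = m
  · rw [hk, place, Function.update_self, Function.update_self]
  · rw [place, Function.update_of_ne hk, Function.update_of_ne hk, place]

section

variable {R : RootedGraph G N S} {F : (ι → G) → G} {c : ι → S × ℝ} {m : ι} {lo hi : S → ι}

/-- All fixed tokens lie on removed arcs, so `m` cannot collide with them inside the cut tree. -/
lemma injective_update_of_mem_cutTree (h : IsCut c m lo hi) {y : G}
    (hy : y ∈ R.cutTree (fun i => (c (lo i)).2) (fun i => (c (hi i)).2)) :
    Function.Injective (Function.update (R.place c) m y) := by
  have hne : ∀ j, j ≠ m → R.place c j ≠ y := by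
    rintro j hj rfl
    exact hy (c j).1 ⟨(c j).2, ⟨h.lo_le _ j hj rfl, h.le_hi _ j hj rfl⟩, rfl⟩
  intro a b hab
  by_cases ha : a = m <;> by_cases hb : b = m
  · rw [ha, hb]
  · rw [ha, Function.update_self, Function.update_of_ne hb] at hab
    exact absurd hab.symm (hne b hb)
  · rw [hb, Function.update_self, Function.update_of_ne ha] at hab
    exact absurd hab (hne a ha)
  · rw [Function.update_of_ne ha, Function.update_of_ne hb] at hab
    obtain ⟨h1, h2⟩ := R.edge_inj (h.mem a ha) (h.mem b hb) hab
    exact h.inj a ha b hb (Prod.ext (Sum.inr.inj h1) h2)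

lemma continuousOn_moving (hF : AvoidsTokens F) (h : IsCut c m lo hi) :
    ContinuousOn (R.moving F c m)
      (R.cutTree (fun i => (c (lo i)).2) (fun i => (c (hi i)).2)) :=
  hF.continuousOn.comp (Continuous.continuousOn (by fun_prop))
    fun _ hy => injective_update_of_mem_cutTree h hy

lemma moving_ne (hF : AvoidsTokens F) (h : IsCut c m lo hi) {y : G}
    (hy : y ∈ R.cutTree (fun i => (c (lo i)).2) (fun i => (c (hi i)).2)) :
    R.moving F c m y ≠ y := by
  have := hF.ne _ (injective_update_of_mem_cutTree h hy) m
  rwa [Function.update_self] at this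

lemma moving_ne_place (hF : AvoidsTokens F) (h : IsCut c m lo hi) {y : G}
    (hy : y ∈ R.cutTree (fun i => (c (lo i)).2) (fun i => (c (hi i)).2)) {j : ι} (hj : j ≠ m) :
    R.moving F c m y ≠ R.place c j := by
  have := hF.ne _ (injective_update_of_mem_cutTree h hy) j
  rwa [Function.update_of_ne hj] at this

/-- Forced positions next to the outermost token make the value point outwards at that end. -/
lemma pointsOutward_true_of_forced (h : IsCut c m lo hi) {i : S}
    (hf : R.Forced F i m (lo i)) :
    R.PointsOutward (fun i => (c (lo i)).2) (fun i => (c (hi i)).2) (R.moving F c m) (i, true) := by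
  intro t ht
  rw [moving_edge]
  have hlo : Function.update c m (i, t) (lo i) = c (lo i) := Function.update_of_ne (h.lo_ne i) ..
  have := hf (Function.update c m (i, t)) (h.isPlacement_update
    ⟨ht.1, by linarith [ht.2, h.lo_le_hi i, h.hi_lt_one i]⟩ fun h' => by linarith [ht.2, h'.1])
    (by rw [Function.update_self]) (by rw [hlo, h.lo_fst])
    (by rw [Function.update_self, hlo]; exact ht.2) (by
      intro j hj hj' harc
      rw [Function.update_self, Function.update_of_ne hj, hlo] at harc
      refine hj' (h.inj j hj _ (h.lo_ne i) (Prod.ext (harc.1.trans (h.lo_fst i).symm)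
        (le_antisymm harc.2.2 (h.lo_le i j hj harc.1)))))
  rw [Function.update_self, hlo] at this
  obtain ⟨z, hz, hz'⟩ := this
  exact ⟨z, hz, hz'.symm⟩

lemma pointsOutward_false_of_forced (h : IsCut c m lo hi) {i : S}
    (hf : R.Forced F i (hi i) m) :
    R.PointsOutward (fun i => (c (lo i)).2) (fun i => (c (hi i)).2) (R.moving F c m)
      (i, false) := by
  intro t ht
  rw [moving_edge]
  have hhi : Function.update c m (i, t) (hi i) = c (hi i) := Function.update_of_ne (h.hi_ne i) ..
  have := hf (Function.update c m (i, t)) (h.isPlacement_update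
    ⟨by linarith [ht.1, h.lo_le_hi i, h.lo_pos i], ht.2⟩ fun h' => by linarith [ht.1, h'.2])
    (by rw [hhi, h.hi_fst]) (by rw [Function.update_self])
    (by rw [Function.update_self, hhi]; exact ht.1) (by
      intro j hj' hj harc
      rw [Function.update_self, Function.update_of_ne hj, hhi] at harc
      refine hj' (h.inj j hj _ (h.hi_ne i) (Prod.ext (harc.1.trans (h.hi_fst i).symm)
        (le_antisymm (h.le_hi i j hj harc.1) harc.2.1))))
  rw [Function.update_self, hhi] at this
  obtain ⟨z, hz, hz'⟩ := this
  exact ⟨z, hz, hz'.symm⟩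

variable [T2Space G] [Finite N] [Finite S]

/-- Either the value stays in the cut tree along with the moving token, or it is trapped between
the outermost fixed tokens of some edge. -/
lemma mapsTo_moving_or (hF : AvoidsTokens F) (h : IsCut c m lo hi) :
    MapsTo (R.moving F c m) (R.cutTree (fun i => (c (lo i)).2) (fun i => (c (hi i)).2))
      (R.cutTree (fun i => (c (lo i)).2) (fun i => (c (hi i)).2)) ∨
    ∃ i, ∀ y ∈ R.cutTree (fun i => (c (lo i)).2) (fun i => (c (hi i)).2),
      R.moving F c m y ∈ R.edge (Sum.inr i) '' Ioo (c (lo i)).2 (c (hi i)).2 := by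
  by_cases hmaps : MapsTo (R.moving F c m)
    (R.cutTree (fun i => (c (lo i)).2) (fun i => (c (hi i)).2))
    (R.cutTree (fun i => (c (lo i)).2) (fun i => (c (hi i)).2))
  · exact Or.inl hmaps
  right
  simp only [MapsTo] at hmaps
  push Not at hmaps
  obtain ⟨y, hy, hyT⟩ := hmaps
  simp only [cutTree, mem_ofPred_eq, not_forall, not_not] at hyT
  obtain ⟨i, z, hz, hzy⟩ := hyT
  have hplo : R.place c (lo i) = R.edge (Sum.inr i) (c (lo i)).2 := by rw [place, h.lo_fst]
  have hphi : R.place c (hi i) = R.edge (Sum.inr i) (c (hi i)).2 := by rw [place, h.hi_fst]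
  have hlo := fun y hy => moving_ne_place (R := R) hF h (y := y) hy (h.lo_ne i)
  have hhi := fun y hy => moving_ne_place (R := R) hF h (y := y) hy (h.hi_ne i)
  rw [hplo] at hlo
  rw [hphi] at hhi
  -- A value outside the cut tree lies strictly inside a removed arc, because the ends of that arc
  -- are tokens. Connectedness of the cut tree then keeps every value there.
  have h1 : (c (lo i)).2 < z := by
    refine lt_of_le_of_ne hz.1 fun heq => hlo y hy ?_
    rw [heq, hzy]
  have h2 : z < (c (hi i)).2 := by
    refine lt_of_le_of_ne hz.2 fun heq => hhi y hy ?_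
    rw [← heq, hzy]
  refine ⟨i, fun y' hy' => ?_⟩
  have hpre := isPreconnected_iff_preconnectedSpace.1
    (R.isPreconnected_cutTree (fun i => h.lo_pos i) (fun i => h.hi_lt_one i))
  exact R.mem_arc_of_preconnected (Sum.inr i)
    (continuousOn_iff_continuous_domRestrict.1 (continuousOn_moving hF h))
    (s := fun _ => (c (lo i)).2) (t := fun _ => (c (hi i)).2) continuous_const continuous_const
    (fun _ => h.lo_pos i) (fun _ => h1.trans h2) (fun _ => h.hi_lt_one i)
    (fun z => hlo z z.2) (fun z => hhi z z.2) (z := ⟨y, hy⟩) (z' := ⟨y', hy'⟩)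
    ⟨z, ⟨h1, h2⟩, hzy⟩

/-- One sample suffices by `forced_of_mem`: here `m` stands halfway between the initial end and the
first fixed token. -/
lemma forced_of_pointsOutward_true [Finite ι] (hF : AvoidsTokens F) (h : IsCut c m lo hi)
    {i k : S} (hki : k ≠ i) (ho : R.PointsOutward (fun i => (c (lo i)).2)
      (fun i => (c (hi i)).2) (R.moving F c m) (i, true)) : R.Forced F i m (lo i) := by
  have hpos := h.lo_pos i
  obtain ⟨z, hz, hz'⟩ := ho ((c (lo i)).2 / 2) ⟨by linarith, by linarith⟩
  rw [moving_edge] at hz'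
  have hlo : ∀ t, Function.update c m (i, t) (lo i) = c (lo i) := fun t =>
    Function.update_of_ne (h.lo_ne i) ..
  refine R.forced_of_mem hF hki (c := Function.update c m (i, (c (lo i)).2 / 2))
    (h.isPlacement_update ⟨by linarith, by linarith [h.lo_le_hi i, h.hi_lt_one i]⟩
      fun h' => by linarith [h'.1]) (by rw [Function.update_self]) (by rw [hlo, h.lo_fst])
    (by rw [Function.update_self, hlo]; dsimp only; linarith) (fun j hj hj' harc => ?_) ?_
  · rw [Function.update_self, Function.update_of_ne hj, hlo] at harc
    exact hj' (h.inj j hj _ (h.lo_ne i) (Prod.ext (harc.1.trans (h.lo_fst i).symm)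
        (le_antisymm harc.2.2 (h.lo_le i j hj harc.1))))
  · rw [Function.update_self, hlo]
    exact ⟨z, hz, hz'.symm⟩

lemma forced_of_pointsOutward_false [Finite ι] (hF : AvoidsTokens F) (h : IsCut c m lo hi)
    {i k : S} (hki : k ≠ i) (ho : R.PointsOutward (fun i => (c (lo i)).2)
      (fun i => (c (hi i)).2) (R.moving F c m) (i, false)) : R.Forced F i (hi i) m := by
  have hpos := h.hi_lt_one i
  have hpos' := (h.lo_pos i).trans_le (h.lo_le_hi i)
  obtain ⟨z, hz, hz'⟩ := ho (((c (hi i)).2 + 1) / 2) ⟨by linarith, by linarith⟩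
  rw [moving_edge] at hz'
  have hhi : ∀ t, Function.update c m (i, t) (hi i) = c (hi i) := fun t =>
    Function.update_of_ne (h.hi_ne i) ..
  refine R.forced_of_mem hF hki (c := Function.update c m (i, ((c (hi i)).2 + 1) / 2))
    (h.isPlacement_update ⟨by linarith, by linarith⟩
      fun h' => by linarith [h'.2]) (by rw [hhi, h.hi_fst]) (by rw [Function.update_self])
    (by rw [Function.update_self, hhi]; dsimp only; linarith) (fun j hj' hj harc => ?_) ?_
  · rw [Function.update_self, Function.update_of_ne hj, hhi] at harc
    exact hj' (h.inj j hj _ (h.hi_ne i) (Prod.ext (harc.1.trans (h.hi_fst i).symm)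
        (le_antisymm (h.le_hi i j hj harc.1) harc.2.1)))
  · rw [Function.update_self, hhi]
    exact ⟨z, hz, hz'.symm⟩

/-- For every way of cutting the graph open by fixed tokens, some pair of neighbouring tokens is
forced. -/
lemma exists_forced [Finite ι] [Nontrivial S] (hF : AvoidsTokens F) (h : IsCut c m lo hi) :
    ∃ i u v, u ≠ v ∧ R.Forced F i u v ∧ (u = m ∨ (c u).1 = i) ∧ (v = m ∨ (c v).1 = i) := by
  rcases mapsTo_moving_or (R := R) hF h with hmaps | ⟨i, hi'⟩
  · obtain ⟨⟨i, σ⟩, hl, -⟩ := R.existsUnique_pointsOutward (fun i => h.lo_pos i)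
      (fun i => h.lo_le_hi i) (fun i => h.hi_lt_one i) (continuousOn_moving hF h) hmaps
      (fun x hx => moving_ne hF h hx)
    obtain ⟨k, hk⟩ := exists_ne i
    cases σ
    · exact ⟨i, hi i, m, h.hi_ne i, forced_of_pointsOutward_false hF h hk hl,
        Or.inr (h.hi_fst i), Or.inl rfl⟩
    · exact ⟨i, m, lo i, (h.lo_ne i).symm, forced_of_pointsOutward_true hF h hk hl,
        Or.inl rfl, Or.inr (h.lo_fst i)⟩
  · obtain ⟨k, hk⟩ := exists_ne i
    have hpos := h.lo_pos i
    have hlt := (h.lo_le_hi i).trans_lt (h.hi_lt_one i)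
    have ht : (c (lo i)).2 / 2 ∈ Ioo (0 : ℝ) 1 := ⟨by linarith, by linarith⟩
    have hout : (c (lo i)).2 / 2 ∉ Icc (c (lo i)).2 (c (hi i)).2 := fun h' => by linarith [h'.1]
    have hyT := (R.edge_inr_mem_cutTree_iff (fun i => h.lo_pos i) (fun i => h.hi_lt_one i) i
      (Ioo_subset_Icc_self ht)).2 hout
    obtain ⟨z, hz, hzy⟩ := hi' _ hyT
    have hz01 : z ∈ Ioo (0 : ℝ) 1 := ⟨hpos.trans hz.1, hz.2.trans (h.hi_lt_one i)⟩
    have hzne : ∀ j, j ≠ m → (c j).1 = i → (c j).2 ≠ z := by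
      intro j hj hji hjz
      refine moving_ne_place hF h hyT hj ?_
      rw [← hzy, place, hji, hjz]
    classical
    have := Fintype.ofFinite ι
    -- In the trapped case, `u` and `v` are the fixed tokens immediately before and after the value
    -- `z`.
    obtain ⟨u, hu, humax⟩ := Finset.exists_max_image
      (Finset.univ.filter fun j => (j ≠ m ∧ (c j).1 = i) ∧ (c j).2 < z) (fun j => (c j).2)
      ⟨lo i, by simpa [h.lo_ne, h.lo_fst] using hz.1⟩
    obtain ⟨v, hv, hvmin⟩ := Finset.exists_min_image
      (Finset.univ.filter fun j => (j ≠ m ∧ (c j).1 = i) ∧ z < (c j).2) (fun j => (c j).2)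
      ⟨hi i, by simpa [h.hi_ne, h.hi_fst] using hz.2⟩
    simp only [Finset.mem_filter, Finset.mem_univ, true_and] at hu humax hv hvmin
    have huv : (c u).2 < (c v).2 := hu.2.trans hv.2
    have hcu : ∀ t, Function.update c m (i, t) u = c u := fun t =>
      Function.update_of_ne hu.1.1 ..
    have hcv : ∀ t, Function.update c m (i, t) v = c v := fun t =>
      Function.update_of_ne hv.1.1 ..
    refine ⟨i, u, v, fun huv' => by rw [huv'] at huv; exact lt_irrefl _ huv, ?_,
      Or.inr hu.1.2, Or.inr hv.1.2⟩
    rw [moving_edge] at hzy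
    refine R.forced_of_mem hF hk (h.isPlacement_update ht hout) (by rw [hcu]; exact hu.1.2)
      (by rw [hcv]; exact hv.1.2) (by rw [hcu, hcv]; exact huv) (fun j hju hjv harc => ?_) ?_
    · rw [hcu, hcv] at harc
      by_cases hj : j = m
      · rw [hj, Function.update_self] at harc
        have h1 := harc.2.1
        have h2 := h.lo_le i u hu.1.1 hu.1.2
        dsimp only at h1
        linarith
      · rw [Function.update_of_ne hj] at harc
        rcases lt_or_gt_of_ne (hzne j hj harc.1) with h1 | h1
        · exact hju (h.inj j hj u hu.1.1 (Prod.ext (harc.1.trans hu.1.2.symm)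
            (le_antisymm (humax j ⟨⟨hj, harc.1⟩, h1⟩) harc.2.1)))
        · exact hjv (h.inj j hj v hv.1.1 (Prod.ext (harc.1.trans hv.1.2.symm)
            (le_antisymm harc.2.2 (hvmin j ⟨⟨hj, harc.1⟩, h1⟩))))
    · rw [hcu, hcv]
      exact ⟨z, ⟨hu.2, hv.2⟩, hzy⟩

/-- At most one end of a cut tree can be pointed at. -/
lemma pointsOutward_unique (hF : AvoidsTokens F) (h : IsCut c m lo hi) {l l' : S × Bool}
    (hl : R.PointsOutward (fun i => (c (lo i)).2) (fun i => (c (hi i)).2) (R.moving F c m) l)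
    (hl' : R.PointsOutward (fun i => (c (lo i)).2) (fun i => (c (hi i)).2) (R.moving F c m) l') :
    l = l' := by
  rcases mapsTo_moving_or (R := R) hF h with hmaps | ⟨i, hi'⟩
  · exact (R.existsUnique_pointsOutward (fun i => h.lo_pos i)
      (fun i => h.lo_le_hi i) (fun i => h.hi_lt_one i) (continuousOn_moving hF h) hmaps
      (fun x hx => moving_ne hF h hx)).unique hl hl'
  · exfalso
    obtain ⟨k, σ⟩ := l
    have hpos := h.lo_pos k
    have hle := h.lo_le_hi k
    have hlt := h.hi_lt_one k
    have contra : ∀ t z, t ∈ Ioo (0 : ℝ) 1 → z ∈ Ioo (0 : ℝ) 1 →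
        t ∉ Icc (c (lo k)).2 (c (hi k)).2 → z ∉ Icc (c (lo k)).2 (c (hi k)).2 →
        R.moving F c m (R.edge (Sum.inr k) t) = R.edge (Sum.inr k) z → False := by
      intro t z ht hz hout hzout heq
      have := hi' _ ((R.edge_inr_mem_cutTree_iff (fun i => h.lo_pos i)
        (fun i => h.hi_lt_one i) k (Ioo_subset_Icc_self ht)).2 hout)
      rw [heq, R.edge_mem_image_iff (Ioo_subset_Icc_self hz)
        fun x hx => ⟨(h.lo_pos i).trans hx.1, hx.2.trans (h.hi_lt_one i)⟩] at this
      obtain ⟨h1, h2⟩ := this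
      obtain rfl := Sum.inr.inj h1
      exact hzout (Ioo_subset_Icc_self h2)
    cases σ
    · obtain ⟨z, hz, hzy⟩ := hl (((c (hi k)).2 + 1) / 2) ⟨by linarith, by linarith⟩
      have := hz.1
      have := hz.2
      exact contra _ z ⟨by linarith, by linarith⟩ ⟨by linarith, by linarith⟩
        (fun h' => by linarith [h'.2]) (fun h' => by linarith [h'.2]) hzy
    · obtain ⟨z, hz, hzy⟩ := hl ((c (lo k)).2 / 2) ⟨by linarith, by linarith⟩
      have := hz.1
      have := hz.2
      exact contra _ z ⟨by linarith, by linarith⟩ ⟨by linarith, by linarith⟩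
        (fun h' => by linarith [h'.1]) (fun h' => by linarith [h'.1]) hzy

end

end RootedGraph

/-! ### Incompatibility of forced pairs -/

/-- Labels for the tokens which use every element of `S` without the token `m`, give `i` to `a`
only, and give `j` to `w`. -/
lemma exists_labels {S ι : Type*} [Finite S] [Finite ι] (hcard : Nat.card S + 1 ≤ Nat.card ι)
    {i j : S} (hij : i ≠ j) {a w m : ι} (haw : a ≠ w) (ham : a ≠ m) (hwm : w ≠ m) :
    ∃ κ : ι → S, κ a = i ∧ κ w = j ∧ (∀ k, k ≠ a → κ k ≠ i) ∧ ∀ s, ∃ k, k ≠ m ∧ κ k = s := by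
  classical
  have := Fintype.ofFinite ι
  have := Fintype.ofFinite S
  rw [Nat.card_eq_fintype_card, Nat.card_eq_fintype_card] at hcard
  have hS : Fintype.card {s // s ∉ ({i, j} : Finset S)} = Fintype.card S - 2 := by
    rw [Fintype.card_subtype_compl, Fintype.card_coe, Finset.card_pair hij]
  have hι : Fintype.card {k // k ∉ ({a, w, m} : Finset ι)} = Fintype.card ι - 3 := by
    rw [Fintype.card_subtype_compl, Fintype.card_coe,
      Finset.card_eq_three.2 ⟨a, w, m, haw, ham, hwm, rfl⟩]
  obtain ⟨e⟩ : Nonempty ({s // s ∉ ({i, j} : Finset S)} ↪ {k // k ∉ ({a, w, m} : Finset ι)}) :=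
    Function.Embedding.nonempty_of_card_le (by omega)
  have hprop : ∀ s, (e s : ι) ≠ a ∧ (e s : ι) ≠ w ∧ (e s : ι) ≠ m := by
    intro s
    have := (e s).2
    simp only [Finset.mem_insert, Finset.mem_singleton, not_or] at this
    exact this
  have hinj : ∀ s s', (e s : ι) = e s' → s = s' := fun s s' h => e.injective (Subtype.ext h)
  -- The embedding `e` reserves a token for each label other than `i` and `j`. The remaining tokens,
  -- `w` and `m` among them, get the default label `j`.
  let κ : ι → S := fun k => if k = a then i else if h : ∃ s, (e s : ι) = k then h.choose else j
  have hκa : κ a = i := if_pos rfl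
  have hκw : κ w = j := by
    have : ¬ ∃ s, (e s : ι) = w := fun ⟨s, hs⟩ => (hprop s).2.1 hs
    exact (if_neg haw.symm).trans (dif_neg this)
  have hκe : ∀ s, κ (e s) = s := by
    intro s
    have h : ∃ s', (e s' : ι) = e s := ⟨s, rfl⟩
    refine (if_neg (hprop s).1).trans ((dif_pos h).trans ?_)
    rw [hinj _ _ h.choose_spec]
  refine ⟨κ, hκa, hκw, fun k hk => ?_, fun s => ?_⟩
  · by_cases h : ∃ s, (e s : ι) = k
    · obtain ⟨s, rfl⟩ := h
      rw [hκe]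
      have := s.2
      simp only [Finset.mem_insert, Finset.mem_singleton, not_or] at this
      exact this.1
    · have : κ k = j := (if_neg hk).trans (dif_neg h)
      rw [this]
      exact hij.symm
  · by_cases hsi : s = i
    · exact ⟨a, ham, hκa.trans hsi.symm⟩
    by_cases hsj : s = j
    · exact ⟨w, hwm, hκw.trans hsj.symm⟩
    · have hs : s ∉ ({i, j} : Finset S) := by simp [hsi, hsj]
      exact ⟨e ⟨s, hs⟩, (hprop _).2.2, hκe ⟨s, hs⟩⟩

namespace RootedGraph

variable {G : Type*} [TopologicalSpace G] {N S ι : Type*} {R : RootedGraph G N S}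
  {F : (ι → G) → G}

/-- Forced in one of the two orders. -/
def ForcedPair (R : RootedGraph G N S) (F : (ι → G) → G) (i : S) (u v : ι) : Prop :=
  R.Forced F i u v ∨ R.Forced F i v u

lemma ForcedPair.symm {i : S} {u v : ι} (h : R.ForcedPair F i u v) : R.ForcedPair F i v u :=
  Or.symm h

lemma isPlacement_of_injective {κ : ι → S} {ρ : ι → ℝ} (hρ : Function.Injective ρ)
    (hρ1 : ∀ k, ρ k ∈ Ioo (0 : ℝ) 1) : IsPlacement fun k => (κ k, ρ k) :=
  ⟨fun _ _ h => hρ (Prod.ext_iff.1 h).2, hρ1⟩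

/-- Disjoint pairs of tokens cannot both be forced on different edges. -/
lemma not_forced_of_disjoint [Finite ι] {i j : S} (hij : i ≠ j) {a b u v : ι} (hab : a ≠ b)
    (huv : u ≠ v) (hau : a ≠ u) (hav : a ≠ v) (hbu : b ≠ u) (hbv : b ≠ v)
    (h : R.Forced F i a b) : ¬ R.Forced F j u v := by
  classical
  intro h'
  -- Only `a < b` are placed on `i`; all others go to `j`, where `u < v` come first. Both pairs are
  -- then adjacent, and the value would lie on two edges.
  obtain ⟨ρ, hρ, hρ1, hord⟩ := exists_injective_mem_Ioo_of_priority (fun k : ι =>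
    if k = a then 0 else if k = b then 1 else if k = u then 0 else if k = v then 1 else 2)
  have hκ := isPlacement_of_injective (κ := fun k : ι => if k = a ∨ k = b then i else j) hρ hρ1
  have h1 := h _ hκ (by simp) (by simp) (hord a b (by simp [hab.symm])) (by
    rintro k hka hkb ⟨hk, -⟩
    simp only [hka, hkb, or_self, if_false] at hk
    exact hij hk.symm)
  have h2 := h' _ hκ (by simp [hau.symm, hbu.symm]) (by simp [hav.symm, hbv.symm])
    (hord u v (by simp [hau.symm, hbu.symm, hav.symm, hbv.symm, huv.symm])) (by
    rintro k hku hkv ⟨hk, hk'⟩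
    have hkab : ¬ (k = a ∨ k = b) := fun hab' => by
      simp only [hab', if_true] at hk
      exact hij hk
    rw [not_or] at hkab
    have := hord v k (by simp [hkab.1, hkab.2, hku, hkv, hav.symm, hbv.symm, huv.symm])
    exact absurd hk'.2 (not_le.2 this))
  obtain ⟨x, hx, hxF⟩ := h1
  obtain ⟨y, hy, hyF⟩ := h2
  have := R.edge_inj ⟨(hρ1 a).1.trans hx.1, hx.2.trans (hρ1 b).2⟩
    ⟨(hρ1 u).1.trans hy.1, hy.2.trans (hρ1 v).2⟩ (hxF.trans hyF.symm)
  exact hij (Sum.inr.inj this.1)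

/-- Two consecutive pairs on the same edge cannot both be forced. -/
lemma not_forced_of_chain [Finite ι] {i : S} {u v w : ι} (huv : u ≠ v) (hvw : v ≠ w)
    (huw : u ≠ w) (h : R.Forced F i u v) : ¬ R.Forced F i v w := by
  classical
  intro h'
  -- All tokens are placed on `i`, beginning with `u < v < w`; the value would lie on both sides of
  -- `v`.
  obtain ⟨ρ, hρ, hρ1, hord⟩ := exists_injective_mem_Ioo_of_priority (fun k : ι =>
    if k = u then 0 else if k = v then 1 else if k = w then 2 else 3)
  have hκ := isPlacement_of_injective (κ := fun _ : ι => i) hρ hρ1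
  have huv' : ρ u < ρ v := hord u v (by simp [huv.symm])
  have hvw' : ρ v < ρ w := hord v w (by simp [huv.symm, hvw.symm, huw.symm])
  have h1 := h _ hκ rfl rfl huv' (by
    rintro k hku hkv ⟨-, hk⟩
    have : ρ v < ρ k := hord v k (by
      simp only [huv.symm, hku, hkv, if_false, if_true]
      split_ifs <;> norm_num)
    exact absurd hk.2 (not_le.2 this))
  have h2 := h' _ hκ rfl rfl hvw' (by
    rintro k hkv hkw ⟨-, hk⟩
    by_cases hku : k = u
    · rw [hku] at hk
      exact absurd hk.1 (not_le.2 huv')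
    · have : ρ w < ρ k := hord w k (by simp [huw.symm, hvw.symm, hku, hkv, hkw])
      exact absurd hk.2 (not_le.2 this))
  obtain ⟨x, hx, hxF⟩ := h1
  obtain ⟨y, hy, hyF⟩ := h2
  have := R.edge_inj ⟨(hρ1 u).1.trans hx.1, hx.2.trans (hρ1 v).2⟩
    ⟨(hρ1 v).1.trans hy.1, hy.2.trans (hρ1 w).2⟩ (hxF.trans hyF.symm)
  have h3 := hx.2
  have h4 := hy.1
  dsimp only at h3 h4
  linarith [this.2]

variable [T2Space G] [Finite N] [Finite S] [Finite ι]

/-- A token cannot form forced pairs with different partners on different edges. -/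
lemma not_forcedPair_of_common (hF : AvoidsTokens F) (hcard : Nat.card S + 1 ≤ Nat.card ι)
    {i j : S} (hij : i ≠ j) {a b w : ι} (hab : a ≠ b) (hwb : w ≠ b) (haw : a ≠ w)
    (h : R.ForcedPair F i a b) : ¬ R.ForcedPair F j w b := by
  classical
  intro h'
  -- The common token `b` is the moving one. As `a` is alone on `i`, it is outermost there on both
  -- sides, so either order of its pair gives an end of `i`; choosing `w` outermost on the proper
  -- side of `j` gives a second end.
  obtain ⟨κ, hκa, hκw, hκi, hκs⟩ := exists_labels hcard hij haw hab hwb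
  have main : ∀ ρ : ι → ℝ, Function.Injective ρ → (∀ k, ρ k ∈ Ioo (0 : ℝ) 1) → ∀ σ' : Bool,
      (σ' = true → R.Forced F j b w ∧ ∀ k, ρ w ≤ ρ k) →
      (σ' = false → R.Forced F j w b ∧ ∀ k, ρ k ≤ ρ w) → False := by
    intro ρ hρ hρ1 σ' htrue hfalse
    obtain ⟨lo, hi, hcut⟩ := exists_isCut (c := fun k => (κ k, ρ k)) (m := b)
      (fun k _ => hρ1 k) (fun k _ k' _ hk => hρ (Prod.ext_iff.1 hk).2) hκs
    have halone : ∀ k, κ k = i → k = a := fun k hk => by_contra fun hka => hκi k hka hk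
    have hloi : lo i = a := halone _ (hcut.lo_fst i)
    have hhii : hi i = a := halone _ (hcut.hi_fst i)
    obtain ⟨σ, hσ⟩ : ∃ σ, R.PointsOutward (fun i => ρ (lo i)) (fun i => ρ (hi i))
        (R.moving F (fun k => (κ k, ρ k)) b) (i, σ) := by
      rcases h with h | h
      · exact ⟨false, pointsOutward_false_of_forced hcut (by rwa [hhii])⟩
      · exact ⟨true, pointsOutward_true_of_forced hcut (by rwa [hloi])⟩
    have hσ' : R.PointsOutward (fun i => ρ (lo i)) (fun i => ρ (hi i))
        (R.moving F (fun k => (κ k, ρ k)) b) (j, σ') := by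
      cases σ' with
      | false =>
        have hhij : hi j = w := hcut.hi_eq hwb hκw fun k _ _ => (hfalse rfl).2 k
        exact pointsOutward_false_of_forced hcut (by rw [hhij]; exact (hfalse rfl).1)
      | true =>
        have hloj : lo j = w := hcut.lo_eq hwb hκw fun k _ _ => (htrue rfl).2 k
        exact pointsOutward_true_of_forced hcut (by rw [hloj]; exact (htrue rfl).1)
    have := pointsOutward_unique hF hcut hσ hσ'
    exact hij (Prod.ext_iff.1 this).1
  rcases h' with h' | h'
  · obtain ⟨ρ, hρ, hρ1, hord⟩ := exists_injective_mem_Ioo_of_priority (fun k : ι =>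
      if k = w then 1 else 0)
    refine main ρ hρ hρ1 false (by simp) fun _ => ⟨h', fun k => ?_⟩
    by_cases hk : k = w
    · rw [hk]
    · exact (hord k w (by simp [hk])).le
  · obtain ⟨ρ, hρ, hρ1, hord⟩ := exists_injective_mem_Ioo_of_priority (fun k : ι =>
      if k = w then 0 else 1)
    refine main ρ hρ hρ1 true (fun _ => ⟨h', fun k => ?_⟩) (by simp)
    by_cases hk : k = w
    · rw [hk]
    · exact (hord w k (by simp [hk])).le

/-- The order of the tokens along the edges is irrelevant here, so any distinct parameters may be
used. -/
lemma exists_forced_of_labels [Nontrivial S] (hF : AvoidsTokens F) {κ : ι → S} {m : ι}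
    (hκ : ∀ s, ∃ k, k ≠ m ∧ κ k = s) :
    ∃ i u v, u ≠ v ∧ R.Forced F i u v ∧ (u = m ∨ κ u = i) ∧ (v = m ∨ κ v = i) := by
  classical
  obtain ⟨ρ, hρ, hρ1, -⟩ := exists_injective_mem_Ioo_of_priority (fun _ : ι => 0)
  obtain ⟨lo, hi, hcut⟩ := exists_isCut (c := fun k => (κ k, ρ k)) (m := m)
    (fun k _ => hρ1 k) (fun k _ k' _ hk => hρ (Prod.ext_iff.1 hk).2) hκ
  exact exists_forced hF hcut

/-- A forced pair forces every pair on the same edge that shares a token with it. -/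
lemma forcedPair_of_forcedPair [Nontrivial S] (hF : AvoidsTokens F)
    (hcard : Nat.card S + 1 ≤ Nat.card ι) {i : S} {a b m : ι} (hab : a ≠ b) (ham : a ≠ m)
    (hbm : b ≠ m) (h : R.ForcedPair F i a b) : R.ForcedPair F i a m := by
  obtain ⟨j, hji⟩ := exists_ne i
  obtain ⟨κ, hκa, hκb, hκi, hκs⟩ := exists_labels hcard hji.symm hab ham hbm
  obtain ⟨i', u, v, huv, hf, hu, hv⟩ := exists_forced_of_labels (R := R) hF hκs
  have halone : ∀ k, κ k = i → k = a := fun k hk => by_contra fun hka => hκi k hka hk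
  by_cases hi : i' = i
  · subst hi
    rcases hu with rfl | hu <;> rcases hv with rfl | hv
    · exact absurd rfl huv
    · obtain rfl := halone v hv
      exact Or.inr hf
    · obtain rfl := halone u hu
      exact Or.inl hf
    · exact absurd ((halone u hu).trans (halone v hv).symm) huv
  -- A forced pair on another edge cannot contain `a`. It either shares `b` with the given pair or
  -- is disjoint from it, and both are excluded.
  · exfalso
    have hau : a ≠ u := by
      rintro rfl
      exact hi ((hu.resolve_left ham).symm.trans hκa)
    have hav : a ≠ v := by
      rintro rfl
      exact hi ((hv.resolve_left ham).symm.trans hκa)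
    have hii : i ≠ i' := Ne.symm hi
    by_cases hbu : b = u
    · subst hbu
      exact not_forcedPair_of_common hF hcard hii hab huv.symm hav h (Or.inr hf)
    by_cases hbv : b = v
    · subst hbv
      exact not_forcedPair_of_common hF hcard hii hab huv hau h (Or.inl hf)
    rcases h with h | h
    · exact not_forced_of_disjoint hii hab huv hau hav hbu hbv h hf
    · exact not_forced_of_disjoint hii hab.symm huv hbu hbv hau hav h hf

/-- No continuous function avoids all tokens if there are more tokens than non-tree edges and at
least two non-tree edges. -/
theorem not_avoidsTokens (R : RootedGraph G N S) (F : (ι → G) → G) (hS : 2 ≤ Nat.card S)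
    (hcard : Nat.card S + 1 ≤ Nat.card ι) : ¬ AvoidsTokens F := by
  classical
  intro hF
  have : Nontrivial S := by
    rw [← Finite.one_lt_card_iff_nontrivial]
    omega
  have := Fintype.ofFinite ι
  have hthree : 2 < Fintype.card ι := by
    rw [← Nat.card_eq_fintype_card]
    omega
  have hthird : ∀ a b : ι, ∃ m, m ≠ a ∧ m ≠ b := by
    intro a b
    have : ({a, b} : Finset ι).card < (Finset.univ : Finset ι).card :=
      (Finset.card_le_two).trans_lt (by rwa [Finset.card_univ])
    obtain ⟨m, -, hm⟩ := Finset.exists_mem_notMem_of_card_lt_card this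
    simp only [Finset.mem_insert, Finset.mem_singleton, not_or] at hm
    exact ⟨m, hm⟩
  obtain ⟨x, y, z, hxy, hxz, hyz⟩ := Fintype.two_lt_card_iff.1 hthree
  obtain ⟨i₀, j₀, hij⟩ := exists_pair_ne S
  obtain ⟨κ, -, -, -, hκ⟩ := exists_labels hcard hij hxy hxz hyz
  obtain ⟨i, a, b, hab, hf, -, -⟩ := exists_forced_of_labels (R := R) hF hκ
  obtain ⟨m, hma, hmb⟩ := hthird a b
  have ham := forcedPair_of_forcedPair hF hcard hab hma.symm hmb.symm (Or.inl hf)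
  have hbm := forcedPair_of_forcedPair hF hcard hab.symm hmb.symm hma.symm (Or.inr hf)
  have ham' : R.Forced F i a m := ham.resolve_right fun h =>
    not_forced_of_chain hma hab hmb h hf
  rcases hbm with h | h
  · exact not_forced_of_chain hab hmb.symm hma.symm hf h
  · exact not_forced_of_chain hma.symm hmb hab ham' h

end RootedGraph

/-! ### Existence of a rooted spanning tree -/

namespace GraphModel

variable {G : Type*} [TopologicalSpace G] {V E : Type*}

/-- The simple graph underlying a graph model. -/
def toSimpleGraph (M : GraphModel G V E) : SimpleGraph V :=
  SimpleGraph.fromRel fun u v => ∃ e, M.src e = u ∧ M.tgt e = v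

/-- The indicator of the component of a vertex, extended constantly over edges, is continuous on
`G`. On a connected space it cannot take both values `0` and `1`. -/
lemma toSimpleGraph_connected [T2Space G] [ConnectedSpace G] [Finite V] [Finite E]
    (M : GraphModel G V E) : M.toSimpleGraph.Connected := by
  classical
  have hne : Nonempty V := by
    obtain ⟨x⟩ := (inferInstance : Nonempty G)
    rcases M.exists_eq x with ⟨v, -⟩ | ⟨e, -⟩
    exacts [⟨v⟩, ⟨M.src e⟩]
  refine SimpleGraph.connected_iff_exists_forall_reachable _ |>.2 ?_
  obtain ⟨r⟩ := hne
  refine ⟨r, fun v => ?_⟩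
  by_contra hv
  let a : V → ℝ := fun v => if M.toSimpleGraph.Reachable r v then 1 else 0
  have ha : ∀ e, a (M.src e) = a (M.tgt e) := by
    intro e
    by_cases heq : M.src e = M.tgt e
    · rw [heq]
    have hadj : M.toSimpleGraph.Adj (M.src e) (M.tgt e) :=
      (SimpleGraph.fromRel_adj _ _ _).2 ⟨heq, Or.inl ⟨e, rfl, rfl⟩⟩
    have : M.toSimpleGraph.Reachable r (M.src e) ↔ M.toSimpleGraph.Reachable r (M.tgt e) :=
      ⟨fun h => h.trans hadj.reachable, fun h => h.trans hadj.symm.reachable⟩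
    simp only [a, this]
  have hcont : Continuous (M.lift a fun e _ => a (M.src e)) := by
    rw [← continuousOn_univ]
    exact M.continuousOn_lift isOpen_univ (fun _ => rfl) ha fun e => continuousOn_const
  have hr : M.lift a (fun e _ => a (M.src e)) (M.vertex r) = 1 := by
    rw [M.lift_vertex]
    exact if_pos (SimpleGraph.Reachable.refl _)
  have hv0 : M.lift a (fun e _ => a (M.src e)) (M.vertex v) = 0 := by
    rw [M.lift_vertex]
    exact if_neg hv
  obtain ⟨x, hx⟩ := mem_range_of_exists_le_of_exists_ge hcont (c := (1 / 2 : ℝ))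
    ⟨M.vertex v, by rw [hv0]; norm_num⟩ ⟨M.vertex r, by rw [hr]; norm_num⟩
  have ha01 : ∀ v, a v ≠ 1 / 2 := by
    intro v
    simp only [a]
    split_ifs <;> norm_num
  rcases M.exists_eq x with ⟨w, rfl⟩ | ⟨e, t, ht, rfl⟩
  · rw [M.lift_vertex] at hx
    exact ha01 _ hx
  · rw [M.lift_edge _ _ _ ht] at hx
    exact ha01 _ hx

/-- The edge is the first step of a shortest walk to the root. -/
lemma exists_parent [T2Space G] [ConnectedSpace G] [Finite V] [Finite E]
    (M : GraphModel G V E) (r v : V) (hv : v ≠ r) :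
    ∃ (e : E) (u : V), ((M.src e = u ∧ M.tgt e = v) ∨ (M.src e = v ∧ M.tgt e = u)) ∧
      M.toSimpleGraph.dist u r < M.toSimpleGraph.dist v r := by
  obtain ⟨p, hp⟩ := M.toSimpleGraph_connected.exists_walk_length_eq_dist v r
  cases p with
  | nil => exact absurd rfl hv
  | @cons _ u _ hadj p =>
    obtain ⟨-, ⟨e, h1, h2⟩ | ⟨e, h1, h2⟩⟩ := (SimpleGraph.fromRel_adj _ _ _).1 hadj
    · refine ⟨e, u, Or.inr ⟨h1, h2⟩, ?_⟩
      have := SimpleGraph.dist_le p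
      rw [SimpleGraph.Walk.length_cons] at hp
      omega
    · refine ⟨e, u, Or.inl ⟨h1, h2⟩, ?_⟩
      have := SimpleGraph.dist_le p
      rw [SimpleGraph.Walk.length_cons] at hp
      omega

/-- A connected finite graph model has a rooted spanning tree. -/
theorem exists_rootedGraph.{u} {G : Type u} [TopologicalSpace G] {V E : Type u} [T2Space G]
    [ConnectedSpace G] [Finite V] [Finite E] (M : GraphModel G V E) :
    ∃ (N S : Type u) (_ : Finite N) (_ : Finite S) (_ : RootedGraph G N S),
      Nat.card V = Nat.card N + 1 ∧ Nat.card E = Nat.card N + Nat.card S := by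
  classical
  obtain ⟨r⟩ := M.toSimpleGraph_connected.nonempty
  choose τ o hτ ho using fun v : {v // v ≠ r} => M.exists_parent r v.1 v.2
  -- If two vertices had the same parent edge, each would be the parent of the other, hence strictly
  -- nearer to the root.
  have hτ_inj : Function.Injective τ := by
    intro v v' heq
    have h1 := hτ v
    have h2 := hτ v'
    have h3 := ho v
    have h4 := ho v'
    rw [heq] at h1
    by_contra hne
    have hne' : (v : V) ≠ v' := fun h => hne (Subtype.ext h)
    have : (v : V) = o v' ∧ (v' : V) = o v := by grind
    rw [← this.1] at h4
    rw [← this.2] at h3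
    exact lt_asymm h3 h4
  let S := {e // e ∉ range τ}
  let lab : {v // v ≠ r} ⊕ S → E := Sum.elim τ Subtype.val
  have hlab : Function.Bijective lab := by
    constructor
    · rintro (v | e) (v' | e') h
      · exact congrArg _ (hτ_inj h)
      · exact absurd ⟨v, h⟩ e'.2
      · exact absurd ⟨v', h.symm⟩ e.2
      · exact congrArg _ (Subtype.ext h)
    · intro e
      by_cases he : e ∈ range τ
      · obtain ⟨v, rfl⟩ := he
        exact ⟨Sum.inl v, rfl⟩
      · exact ⟨Sum.inr ⟨e, he⟩, rfl⟩
  let val : Option {v // v ≠ r} → V := fun w => w.elim r Subtype.val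
  let opt : V → Option {v // v ≠ r} := fun v => if h : v = r then none else some ⟨v, h⟩
  have hval : ∀ v, val (opt v) = v := by
    intro v
    by_cases h : v = r
    · simp [val, opt, h]
    · simp [val, opt, h]
  have hval_inj : Function.Injective val := by
    rintro (_ | v) (_ | v') h
    · rfl
    · exact absurd h.symm v'.2
    · exact absurd h v.2
    · exact congrArg _ (Subtype.ext h)
  -- The value `false` marks the tree edges to be reversed so that all run from parent to child.
  let fl : {v // v ≠ r} ⊕ S → Bool := Sum.elim (fun v => decide (M.tgt (τ v) = v)) fun _ => true
  let src : {v // v ≠ r} ⊕ S → Option {v // v ≠ r} :=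
    Sum.elim (fun v => opt (o v)) fun e => opt (M.src e)
  let tgt : {v // v ≠ r} ⊕ S → Option {v // v ≠ r} := Sum.elim some fun e => opt (M.tgt e)
  have hends : ∀ e, M.edge (lab e) (endDist (fl e) 0) = M.vertex (val (src e)) ∧
      M.edge (lab e) (endDist (fl e) 1) = M.vertex (val (tgt e)) := by
    rintro (v | e)
    · have h1 := hτ v
      have h2 := ho v
      by_cases h : M.tgt (τ v) = v
      · have hsrc : M.src (τ v) = o v := by
          rcases h1 with h1 | h1
          · exact h1.1
          · rw [← h1.2, h] at h2
            exact absurd h2 (lt_irrefl _)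
        have hfl : fl (Sum.inl v) = true := decide_eq_true h
        rw [hfl]
        refine ⟨?_, ?_⟩
        · change M.edge (τ v) 0 = M.vertex (val (opt (o v)))
          rw [M.edge_zero, hsrc, hval]
        · change M.edge (τ v) 1 = M.vertex v
          rw [M.edge_one, h]
      · obtain ⟨h3, h4⟩ := h1.resolve_left fun h1 => h h1.2
        have hfl : fl (Sum.inl v) = false := decide_eq_false h
        rw [hfl]
        refine ⟨?_, ?_⟩
        · change M.edge (τ v) (1 - 0) = M.vertex (val (opt (o v)))
          rw [sub_zero, M.edge_one, h4, hval]
        · change M.edge (τ v) (1 - 1) = M.vertex v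
          rw [sub_self, M.edge_zero, h3]
    · refine ⟨?_, ?_⟩
      · change M.edge e 0 = M.vertex (val (opt (M.src e)))
        rw [M.edge_zero, hval]
      · change M.edge e 1 = M.vertex (val (opt (M.tgt e)))
        rw [M.edge_one, hval]
  refine ⟨{v // v ≠ r}, S, inferInstance, inferInstance,
    { vertex := fun w => M.vertex (val w)
      edge := fun e t => M.edge (lab e) (endDist (fl e) t)
      src := src
      tgt := tgt
      continuousOn_edge := fun e => (M.continuousOn_edge (lab e)).comp ?_ ?_
      edge_zero := fun e => (hends e).1
      edge_one := fun e => (hends e).2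
      vertex_injective := M.vertex_injective.comp hval_inj
      edge_inj := fun ht ht' h => ?_
      edge_ne_vertex := fun ht => M.edge_ne_vertex (endDist_mem_Ioo ht)
      exists_eq := fun x => ?_
      tgt_inl := fun _ => rfl
      depth := fun w => M.toSimpleGraph.dist (val w) r
      depth_src_lt := fun v => ?_ }, ?_, ?_⟩
  · cases fl e
    · exact (continuous_const.sub continuous_id).continuousOn
    · exact continuousOn_id
  · intro t ht
    cases fl e
    · exact ⟨by simpa [endDist] using ht.2, by simpa [endDist] using ht.1⟩
    · exact ht
  · obtain ⟨h1, h2⟩ := M.edge_inj (endDist_mem_Ioo ht) (endDist_mem_Ioo ht') h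
    obtain rfl := hlab.injective h1
    exact ⟨rfl, endDist_injective _ h2⟩
  · rcases M.exists_eq x with ⟨v, rfl⟩ | ⟨e, t, ht, rfl⟩
    · exact Or.inl ⟨opt v, by rw [hval]⟩
    · obtain ⟨e, rfl⟩ := hlab.surjective e
      exact Or.inr ⟨e, endDist (fl e) t, endDist_mem_Ioo ht, by rw [endDist_endDist]⟩
  · change M.toSimpleGraph.dist (val (opt (o v))) r < M.toSimpleGraph.dist v r
    rw [hval]
    exact ho v
  · rw [← Finite.card_option]
    exact (Nat.card_eq_of_bijective val ⟨hval_inj, fun v => ⟨opt v, hval v⟩⟩).symm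
  · rw [← Nat.card_sum]
    exact (Nat.card_eq_of_bijective lab hlab).symm

end GraphModel

/-! ### From CW complexes to graph models -/

section CWComplex

open Topology.CWComplex Metric

variable {G : Type*} [TopologicalSpace G] [Topology.CWComplex (Set.univ : Set G)]

lemma const_mem_closedBall_iff {x : ℝ} :
    (fun _ => x : Fin 1 → ℝ) ∈ closedBall (0 : Fin 1 → ℝ) 1 ↔ x ∈ Icc (-1 : ℝ) 1 := by
  rw [mem_closedBall_zero_iff, pi_norm_const, Real.norm_eq_abs, abs_le, mem_Icc]

lemma const_mem_ball_iff {x : ℝ} :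
    (fun _ => x : Fin 1 → ℝ) ∈ ball (0 : Fin 1 → ℝ) 1 ↔ x ∈ Ioo (-1 : ℝ) 1 := by
  rw [mem_ball_zero_iff, pi_norm_const, Real.norm_eq_abs, abs_lt, mem_Ioo]

lemma closedCell_zero_eq (v : cell (Set.univ : Set G) 0) :
    closedCell 0 v = {map (C := (Set.univ : Set G)) 0 v 0} := by
  ext x
  constructor
  · rintro ⟨y, -, rfl⟩
    rw [Subsingleton.elim y 0]
    rfl
  · rintro rfl
    exact map_zero_mem_closedCell 0 v

lemma exists_vertex_of_mem_cellFrontier {e : cell (Set.univ : Set G) 1} {x : G}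
    (hx : x ∈ cellFrontier 1 e) :
    ∃ v : cell (Set.univ : Set G) 0, map (C := (Set.univ : Set G)) 0 v 0 = x := by
  obtain ⟨I, hI⟩ := cellFrontier_subset_finite_closedCell 1 e
  have := hI hx
  simp only [mem_iUnion] at this
  obtain ⟨m, hm, v, -, hv⟩ := this
  obtain rfl : m = 0 := by omega
  rw [closedCell_zero_eq] at hv
  exact ⟨v, hv.symm⟩

/-- A one-dimensional CW complex as a graph model. -/
lemma exists_graphModel (hdim : ∀ m : ℕ, 1 < m → IsEmpty (cell (Set.univ : Set G) m)) :
    Nonempty (GraphModel G (cell (Set.univ : Set G) 0) (cell (Set.univ : Set G) 1)) := by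
  have hend : ∀ (e : cell (Set.univ : Set G) 1) (x : ℝ), |x| = 1 →
      ∃ v : cell (Set.univ : Set G) 0, map (C := (Set.univ : Set G)) 0 v 0 =
        map (C := (Set.univ : Set G)) 1 e fun _ => x := by
    intro e x hx
    refine exists_vertex_of_mem_cellFrontier (e := e) ⟨_, ?_, rfl⟩
    rw [mem_sphere_zero_iff_norm, pi_norm_const, Real.norm_eq_abs, hx]
  -- The characteristic map of a 1-cell lives on `[-1, 1]`, hence the substitution `2 * t - 1`.
  choose src hsrc using fun e => hend e (-1) (by norm_num)
  choose tgt htgt using fun e => hend e 1 (by norm_num)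
  have hball : ∀ {t : ℝ}, t ∈ Ioo (0 : ℝ) 1 →
      (fun _ => 2 * t - 1 : Fin 1 → ℝ) ∈ ball (0 : Fin 1 → ℝ) 1 := fun ht =>
    const_mem_ball_iff.2 ⟨by linarith [ht.1], by linarith [ht.2]⟩
  have hopen : ∀ {t : ℝ} (e : cell (Set.univ : Set G) 1), t ∈ Ioo (0 : ℝ) 1 →
      map (C := (Set.univ : Set G)) 1 e (fun _ => 2 * t - 1) ∈ openCell 1 e := fun e ht =>
    ⟨_, hball ht, rfl⟩
  refine ⟨{
    vertex := fun v => map (C := (Set.univ : Set G)) 0 v 0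
    edge := fun e t => map (C := (Set.univ : Set G)) 1 e fun _ => 2 * t - 1
    src := src
    tgt := tgt
    continuousOn_edge := fun e => (continuousOn 1 e).comp (by fun_prop) fun t ht =>
      const_mem_closedBall_iff.2 ⟨by linarith [ht.1], by linarith [ht.2]⟩
    edge_zero := fun e => by rw [hsrc]; norm_num
    edge_one := fun e => by rw [htgt]; norm_num
    vertex_injective := fun v v' h => ?_
    edge_inj := fun {e e' t t'} ht ht' h => ?_
    edge_ne_vertex := fun {e t v} ht h => ?_
    exists_eq := fun x => ?_ }⟩
  · by_contra hne
    have h1 := map_zero_mem_openCell (C := (Set.univ : Set G)) 0 v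
    have h2 := map_zero_mem_openCell (C := (Set.univ : Set G)) 0 v'
    refine Set.disjoint_left.1 (disjoint_openCell_of_ne (i := v) (j := v') (by simpa using hne))
      h1 ?_
    dsimp only at h
    rw [h]
    exact h2
  · have hee : e = e' := by
      by_contra hne
      refine Set.disjoint_left.1 (disjoint_openCell_of_ne (i := e) (j := e')
        (by simpa using hne)) (hopen e ht) ?_
      rw [h]
      exact hopen e' ht'
    subst hee
    refine ⟨rfl, ?_⟩
    have := (map (C := (Set.univ : Set G)) 1 e).injOn
      (by rw [source_eq]; exact hball ht) (by rw [source_eq]; exact hball ht') h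
    have : 2 * t - 1 = 2 * t' - 1 := congrFun this 0
    linarith
  · refine Set.disjoint_left.1 (disjoint_openCell_of_ne (i := e) (j := v) (by simp))
      (hopen e ht) ?_
    rw [h]
    exact map_zero_mem_openCell 0 v
  · have hx : x ∈ ⋃ (n : ℕ) (j : cell (Set.univ : Set G) n), closedCell n j := by
      rw [Topology.CWComplex.union]
      trivial
    simp only [mem_iUnion] at hx
    obtain ⟨m, j, hj⟩ := hx
    rcases Nat.lt_or_ge 1 m with hm | hm
    · exact ((hdim m hm).false j).elim
    · obtain rfl | rfl : m = 0 ∨ m = 1 := by omega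
      · rw [closedCell_zero_eq] at hj
        exact Or.inl ⟨j, hj.symm⟩
      · rw [← cellFrontier_union_openCell_eq_closedCell] at hj
        rcases hj with hj | ⟨y, hy, rfl⟩
        · exact Or.inl (exists_vertex_of_mem_cellFrontier hj)
        · have hy' : y = fun _ => y 0 := by
            funext k
            rw [Subsingleton.elim k 0]
          rw [hy', const_mem_ball_iff] at hy
          refine Or.inr ⟨j, (y 0 + 1) / 2, ⟨by linarith [hy.1], by linarith [hy.2]⟩, ?_⟩
          conv_rhs => rw [hy']
          congr 1
          funext _
          ring

end CWComplex

theorem theorem1 (G : Type*) [TopologicalSpace G] [Topology.CWComplex (Set.univ : Set G)]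
    (hG : IsFiniteGraph G) (hχ : graphEulerChar G < 0)
    (n : ℕ) (hn : 2 - graphEulerChar G ≤ (n : ℤ)) :
    (¬ ∃ s : Conf n G → Conf (n + 1) G, IsSection s) ∧
      ¬ ∃ f : Conf n G → G, IsIdentifyingFunction f := by
  have hid : ¬ ∃ f : Conf n G → G, IsIdentifyingFunction f := by
    classical
    rintro ⟨f, hf, hne⟩
    have := hG.t2
    have := hG.connected
    have := hG.finite
    have hfin : ∀ m, Finite (Topology.CWComplex.cell (Set.univ : Set G) m) := fun m =>
      Topology.CWComplex.FiniteType.finite_cell (C := (Set.univ : Set G)) m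
    have := hfin 0
    have := hfin 1
    obtain ⟨M⟩ := exists_graphModel hG.dim_le_one
    obtain ⟨N, S, hN, hS, R, hV, hE⟩ := M.exists_rootedGraph
    -- The tree edges cancel against the vertices other than the root.
    have heuler : graphEulerChar G = 1 - Nat.card S := by
      change (Nat.card (Topology.RelCWComplex.cell (Set.univ : Set G) 0) : ℤ) -
        Nat.card (Topology.RelCWComplex.cell (Set.univ : Set G) 1) = _
      rw [hV, hE]
      push_cast
      ring
    rw [heuler] at hχ hn
    have hn0 : 0 < n := by omega
    -- The value on non-injective tuples is arbitrary.
    let F : (Fin n → G) → G := fun x => if h : Function.Injective x then f ⟨x, h⟩ else x ⟨0, hn0⟩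
    have hFf : ∀ x : Conf n G, F x.1 = f x := fun x => dif_pos x.2
    refine R.not_avoidsTokens F (by omega) (by rw [Nat.card_fin]; omega)
      ⟨?_, fun x hx i => ?_⟩
    · rw [continuousOn_iff_continuous_domRestrict]
      exact hf.congr fun x => (hFf x).symm
    · rw [show F x = f ⟨x, hx⟩ from hFf ⟨x, hx⟩]
      exact hne ⟨x, hx⟩ i
  refine ⟨?_, hid⟩
  rintro ⟨s, hs, hsec⟩
  -- The last token of a section is an identifying function.
  refine hid ⟨fun x => (s x).1 (Fin.last n), ?_, fun x i h => ?_⟩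
  · exact (continuous_apply _).comp (continuous_subtype_val.comp hs)
  · have hx : forget n G (s x) = x := congrFun hsec x
    have hxi : (s x).1 i.castSucc = x.1 i := congrFun (congrArg Subtype.val hx) i
    have := (s x).2 (hxi.trans h.symm)
    exact (Fin.castSucc_lt_last i).ne this
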